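/- **Setting.** For $m\ge 1$ let $\mathcal T_m=\{(-i,j)\in\mathbb Z^2: 0\le i\le j\le m-1\}$, the triangle with corners $(0,0)$, $(1-m,m-1)$, $(0,m-1)$, in the triangular lattice drawn on $\mathbb Z^2$ with horizontal, diagonal and vertical edges, i.e. edges $(v,v+s)$ with $s\in\{(1,0),(1,-1),(0,-1)\}$. A 20V configuration on $\mathcal T_m$ is an orientation of all edges incident to $\mathcal T_m$ (external edges included) such that each vertex of $\mathcal T_m$ has three incoming and three outgoing edges. Edges oriented to the right or downwards (along $s$) are called *occupied*; they form osculating Schröder paths. A vertex is visited by a path if an edge at it is occupied. The external edges are: the vertical and diagonal edges above the vertices $(-i,m-1)$ of the North boundary; the horizontal and diagonal edges to the right of the vertices $(0,i)$ of the East boundary; and the horizontal edge to the left of, and the vertical edge below, each vertex $(-i,i)$ of the diagonal boundary ($0\le i\le m-1$). All configurations have weight $1$, and the models are defined by the following boundary conditions. * $20V_3$: North edges point out (are empty) and East edges point in (are empty). Diagonal boundary edges point in on the top half and out on the bottom half; for odd $m$, at the middle vertex the horizontal one points in and the vertical one points out. That is, the horizontal edge at $(-i,i)$ is occupied iff $2i+1\ge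 m$, and the vertical edge at $(-i,i)$ is occupied iff $2i+1\le m$. $Z^{20V_3}_{m,k}$ is the number of configurations for which the topmost vertex of the rightmost column visited by a path is at position $k\in\{1,\dots,m\}$, counted from bottom to top (the position where the top path first hits that column). * $20V_2$ (image of $20V_3$ under flipping the vertical edges, reflecting in a horizontal line, and shearing back to $\mathcal T_m$): East edges and horizontal diagonal-boundary edges are empty, vertical diagonal-boundary edges are occupied; above $(-i,m-1)$, the vertical edge is occupied iff $2i\ge m$ and the diagonal edge is occupied iff $2i+1\ge m$. $Z^{20V_2}_{m,k}$ is defined by the same refinement as $Z^{20V_3}_{m,k}$. * $20V_1$ (image of $20V_2$ under the reflection $(x,y)\mapsto(y-(m-1),x+(m-1))$): North edges and vertical diagonal-boundary edges are empty, horizontal diagonal-boundary edges are occupied; to the right of $(0,i)$, the horizontal edge is occupied iff $2i+2\le m$ and the diagonal edge is occupied iff $2i+1\le m$. $Z^{20V_1}_{m,k}$ is the number of configurations for which the topmost path leaves the topmost horizontal line at position $k$, counted from left to right. Put $Z^{20V_i}_m(\tau)=\sum_{k=1}^m Z^{20V_i}_{m,k}\,\tau^{k-1}$ for $i=1,2,3$.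 For $n\ge1$, consider the six-vertex model on the $n\times n$ square grid with domain wall boundary conditions: each vertex has two incoming and two outgoing edges, the horizontal external edges point in and the vertical external edges point out. In terms of osculating paths formed by the edges oriented to the right or downwards, a vertex has weight $a=1$ if it is empty or touched by two paths, $b=\sqrt2$ if a single path passes straight through it, and $c=1$ if a single path turns at it. Let $Z^{6V_1}_{n,k}$ be the sum, over configurations for which the topmost vertex of the last (rightmost) column visited by a path is at position $k$ (counted from bottom to top), of the product of the vertex weights, and put $Z^{6V_1}_n(\sigma)=\sum_{k=1}^n Z^{6V_1}_{n,k}\,\sigma^{k-1}$. **Theorem.** For all $n\ge 1$ and all $\tau\in\mathbb C$, $$Z^{20V_3}_{2n}(\tau)=2^{\frac{n(n-1)}2}(\tau+1)^n\,Z^{6V_1}_n\!\left(\tfrac{\tau+1}2\right),\qquad Z^{20V_3}_{2n-1}(\tau)=2^{\frac{(n-1)(n-2)}2}(\tau+1)^{n-1}\,Z^{6V_1}_n\!\left(\tfrac{\tau+1}2\right).$$ Moreover, for all $m\ge1$, $Z^{20V_1}_m(\tau)=Z^{20V_2}_m(\tau)$ for all $\tau\in\mathbb C$, and $Z^{20V_2}_m(\tau)=\tau^{m-1}Z^{20V_3}_m(\tau^{-1})$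 for all $\tau\in\mathbb C\setminus\{0\}$. -/

import Mathlib

namespace VertexModel

/-- A lattice step, i.e. the direction vector of an edge. -/
abbrev Step := ℤ × ℤ

/-- An edge of the lattice `ℤ × ℤ`: the pair `(v, s)` is the edge joining `v` to `v + s`. -/
abbrev Edge := (ℤ × ℤ) × Step

/-- The horizontal step. -/
abbrev hor : Step := (1, 0)

/-- The diagonal step. -/
abbrev dia : Step := (1, -1)

/-- The (downward) vertical step. -/
abbrev ver : Step := (0, -1)

/-- The steps of the triangular lattice (drawn on `ℤ × ℤ`), on which the 20V model lives. -/
def triSteps : Finset Step := {hor, dia, ver}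

/-- The steps of the square lattice, on which the 6V model lives. -/
def sqSteps : Finset Step := {hor, ver}

/-- All edges with a step in `D` that are incident to a vertex of the domain `V`, including the
external (boundary) edges, which have only one endpoint in `V`. -/
def edges (D : Finset Step) (V : Finset (ℤ × ℤ)) : Finset Edge :=
  (V ×ˢ D) ∪ (V ×ˢ D).image (fun e => (e.1 - e.2, e.2))

/-! An orientation of all the edges of a domain is recorded by the set `A` of those edges that are
oriented along their step (to the right, or down); the other edges are oriented backwards.
In the (osculating) path formulation, `A` is the set of edges occupied by a path. -/

/-- Number of edges at `v` that are oriented towards `v`. -/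
def inDeg (D : Finset Step) (A : Finset Edge) (v : ℤ × ℤ) : ℕ :=
  (D.filter (fun s => (v - s, s) ∈ A)).card + (D.filter (fun s => (v, s) ∉ A)).card

/-- Number of edges at `v` that are oriented away from `v`. -/
def outDeg (D : Finset Step) (A : Finset Edge) (v : ℤ × ℤ) : ℕ :=
  (D.filter (fun s => (v, s) ∈ A)).card + (D.filter (fun s => (v - s, s) ∉ A)).card

/-- The orientations of the edges of `V` that obey the ice rule at every vertex of `V`: as many
incoming as outgoing edges, namely three of each for `D = triSteps` and two for `D = sqSteps`. -/
def iceConfigs (D : Finset Step) (V : Finset (ℤ × ℤ)) : Finset (Finset Edge) :=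
  (edges D V).powerset.filter
    (fun A => ∀ v ∈ V, inDeg D A v = D.card ∧ outDeg D A v = D.card)

/-- The vertex `v` is visited by a path. -/
def Visited (D : Finset Step) (A : Finset Edge) (v : ℤ × ℤ) : Prop :=
  ∃ s ∈ D, (v - s, s) ∈ A ∨ (v, s) ∈ A

instance (D : Finset Step) (A : Finset Edge) (v : ℤ × ℤ) : Decidable (Visited D A v) := by
  unfold Visited; infer_instance

/-- In a domain whose rightmost column consists of the vertices `(0, 0), …, (0, m - 1)`, the topmost
vertex of that column visited by a path is at position `k`, counted `1, …, m` from bottom to top. -/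
def HitsLastColumnAt (D : Finset Step) (m : ℕ) (A : Finset Edge) (k : ℕ) : Prop :=
  Visited D A (0, (k : ℤ) - 1) ∧ ∀ j ∈ Finset.Ioc k m, ¬ Visited D A (0, (j : ℤ) - 1)

instance (D : Finset Step) (m : ℕ) (A : Finset Edge) (k : ℕ) :
    Decidable (HitsLastColumnAt D m A k) := by
  unfold HitsLastColumnAt; infer_instance

/-- In the triangle below, a path leaves the topmost horizontal line (by a diagonal or a vertical
step) at position `k`, counted `1, …, m` from left to right. -/
def LeavesTopLineAt (m : ℕ) (A : Finset Edge) (k : ℕ) : Prop :=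
  (((k : ℤ) - m, (m : ℤ) - 1), dia) ∈ A ∨ (((k : ℤ) - m, (m : ℤ) - 1), ver) ∈ A

instance (m : ℕ) (A : Finset Edge) (k : ℕ) : Decidable (LeavesTopLineAt m A k) := by
  unfold LeavesTopLineAt; infer_instance

/-! ### The 20V models on the triangle -/

/-- The triangle of size `m`, with corners `(0, 0)`, `(1 - m, m - 1)` and `(0, m - 1)`: the vertices
`(-i, j)` with `0 ≤ i ≤ j ≤ m - 1`. -/
def triangle (m : ℕ) : Finset (ℤ × ℤ) :=
  ((Finset.range m ×ˢ Finset.range m).filter (fun p => p.1 ≤ p.2)).image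
    (fun p => (-(p.1 : ℤ), (p.2 : ℤ)))

/-! External edges of the triangle, for `i = 0, …, m - 1`: two edges end at the vertex `(-i, m - 1)`
of the North boundary (one vertical, one diagonal), two edges start at the vertex `(0, i)` of the
East boundary (one horizontal, one diagonal), and one horizontal edge ends, one vertical edge starts,
at the vertex `(-i, i)` of the diagonal boundary. -/

/-- The vertical external edge above the North boundary, in column `-i`. -/
def northVer (m i : ℕ) : Edge := ((-(i : ℤ), (m : ℤ)), ver)

/-- The diagonal external edge above the North boundary, ending in column `-i`. -/
def northDia (m i : ℕ) : Edge := ((-(i : ℤ) - 1, (m : ℤ)), dia)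

/-- The horizontal external edge on the East boundary, in row `i`. -/
def eastHor (i : ℕ) : Edge := ((0, (i : ℤ)), hor)

/-- The diagonal external edge on the East boundary, starting in row `i`. -/
def eastDia (i : ℕ) : Edge := ((0, (i : ℤ)), dia)

/-- The horizontal external edge on the diagonal boundary, in row `i`. -/
def diagHor (i : ℕ) : Edge := ((-(i : ℤ) - 1, (i : ℤ)), hor)

/-- The vertical external edge on the diagonal boundary, in column `-i`. -/
def diagVer (i : ℕ) : Edge := ((-(i : ℤ), (i : ℤ)), ver)

/-- Boundary conditions of the model 20V₃: North edges point out, East edges point in, edges on the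
top half of the diagonal boundary point in and on its bottom half point out; for odd `m`, at the
middle vertex of the diagonal boundary, the horizontal edge points in and the vertical one out. -/
def Boundary3 (m : ℕ) (A : Finset Edge) : Prop :=
  ∀ i ∈ Finset.range m,
    northVer m i ∉ A ∧ northDia m i ∉ A ∧ eastHor i ∉ A ∧ eastDia i ∉ A ∧
    (diagHor i ∈ A ↔ m ≤ 2 * i + 1) ∧ (diagVer i ∈ A ↔ 2 * i + 1 ≤ m)

instance (m : ℕ) (A : Finset Edge) : Decidable (Boundary3 m A) := by
  unfold Boundary3; infer_instance

/-- Boundary conditions of the model 20V₂ (image of those of 20V₃ under flipping all vertical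
edges, reflecting in a horizontal line, and shearing back to the triangle): no path crosses the East
boundary, a path leaves through each vertical edge of the diagonal boundary, none enters through its
horizontal edges, and paths enter through both edges at the vertices of the left half of the North
boundary; for odd `m`, one path enters at its middle vertex, through the diagonal edge. -/
def Boundary2 (m : ℕ) (A : Finset Edge) : Prop :=
  ∀ i ∈ Finset.range m,
    (northVer m i ∈ A ↔ m ≤ 2 * i) ∧ (northDia m i ∈ A ↔ m ≤ 2 * i + 1) ∧
    eastHor i ∉ A ∧ eastDia i ∉ A ∧ diagHor i ∉ A ∧ diagVer i ∈ A

instance (m : ℕ) (A : Finset Edge) : Decidable (Boundary2 m A) := by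
  unfold Boundary2; infer_instance

/-- Boundary conditions of the model 20V₁: the image of those of 20V₂ under the reflection
`(x, y) ↦ (y - (m - 1), x + (m - 1))`, which exchanges horizontal and vertical edges (paths being
traversed backwards). -/
def Boundary1 (m : ℕ) (A : Finset Edge) : Prop :=
  ∀ i ∈ Finset.range m,
    northVer m i ∉ A ∧ northDia m i ∉ A ∧
    (eastHor i ∈ A ↔ 2 * i + 2 ≤ m) ∧ (eastDia i ∈ A ↔ 2 * i + 1 ≤ m) ∧
    diagHor i ∈ A ∧ diagVer i ∉ A

instance (m : ℕ) (A : Finset Edge) : Decidable (Boundary1 m A) := by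
  unfold Boundary1; infer_instance

/-- The number of 20V₃ configurations on the triangle of size `m` with refinement position `k`. -/
def count3 (m k : ℕ) : ℕ :=
  ((iceConfigs triSteps (triangle m)).filter
    (fun A => Boundary3 m A ∧ HitsLastColumnAt triSteps m A k)).card

/-- The number of 20V₂ configurations on the triangle of size `m` with refinement position `k`. -/
def count2 (m k : ℕ) : ℕ :=
  ((iceConfigs triSteps (triangle m)).filter
    (fun A => Boundary2 m A ∧ HitsLastColumnAt triSteps m A k)).card

/-- The number of 20V₁ configurations on the triangle of size `m` with refinement position `k`. -/
def count1 (m k : ℕ) : ℕ :=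
  ((iceConfigs triSteps (triangle m)).filter
    (fun A => Boundary1 m A ∧ LeavesTopLineAt m A k)).card

/-- The refined generating polynomial of the 20V₃ model. -/
noncomputable def Z20V3 (m : ℕ) (τ : ℂ) : ℂ := ∑ k ∈ Finset.Icc 1 m, (count3 m k : ℂ) * τ ^ (k - 1)

/-- The refined generating polynomial of the 20V₂ model. -/
noncomputable def Z20V2 (m : ℕ) (τ : ℂ) : ℂ := ∑ k ∈ Finset.Icc 1 m, (count2 m k : ℂ) * τ ^ (k - 1)

/-- The refined generating polynomial of the 20V₁ model. -/
noncomputable def Z20V1 (m : ℕ) (τ : ℂ) : ℂ := ∑ k ∈ Finset.Icc 1 m, (count1 m k : ℂ) * τ ^ (k - 1)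

/-! ### The 6V model on the square, with domain wall boundary conditions -/

/-- The square grid of size `n`, with bottom right corner `(0, 0)`: the vertices `(-i, j)` with
`0 ≤ i, j ≤ n - 1`. -/
def square (n : ℕ) : Finset (ℤ × ℤ) :=
  (Finset.range n ×ˢ Finset.range n).image (fun p => (-(p.1 : ℤ), (p.2 : ℤ)))

/-- Domain wall boundary conditions: horizontal external edges point in and vertical external edges
point out. -/
def BoundaryDW (n : ℕ) (A : Finset Edge) : Prop :=
  ∀ i ∈ Finset.range n,
    ((-(n : ℤ), (i : ℤ)), hor) ∈ A ∧ ((0, (i : ℤ)), hor) ∉ A ∧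
    ((-(i : ℤ), (n : ℤ)), ver) ∉ A ∧ ((-(i : ℤ), 0), ver) ∈ A

instance (n : ℕ) (A : Finset Edge) : Decidable (BoundaryDW n A) := by
  unfold BoundaryDW; infer_instance

/-- The 6V weight of the vertex `v`: `b` if a single path goes straight through `v`, `c` if a single
path turns at `v`, and `a` if `v` is empty or touched by two paths. -/
def weight6V {R : Type*} (a b c : R) (A : Finset Edge) (v : ℤ × ℤ) : R :=
  if ((v - hor, hor) ∈ A ↔ (v, hor) ∈ A) then
    if ((v - hor, hor) ∈ A ↔ (v - ver, ver) ∈ A) then a else b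
  else c

/-- The 6V partition function with domain wall boundary conditions on the square grid of size `n`,
restricted to configurations with refinement position `k`. -/
def part6V {R : Type*} [CommSemiring R] (a b c : R) (n k : ℕ) : R :=
  ∑ A ∈ (iceConfigs sqSteps (square n)).filter
      (fun A => BoundaryDW n A ∧ HitsLastColumnAt sqSteps n A k),
    ∏ v ∈ square n, weight6V a b c A v

/-- The refined 6V partition function with uniform weights `(a, b, c) = (1, √2, 1)`. -/
noncomputable def Z6V (n : ℕ) (σ : ℂ) : ℂ :=
  ∑ k ∈ Finset.Icc 1 n, part6V (1 : ℂ) ((Real.sqrt 2 : ℝ) : ℂ) 1 n k * σ ^ (k - 1)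

end VertexModel

/-! A 20V vertex is the meeting point of a horizontal, a diagonal and a vertical line. Its weight is
that of a small triangle of three six-vertex crossings, with matrices `wHV`, `wDV`, `wHD`. All three
have the same anisotropy $(a^2+b^2-cc')/(2ab)=1/\sqrt2$, where $c,c'$ are the two turning weights.
The parameter $b$ may be chosen column by column, and for every $b\ne0$ the Yang–Baxter equation
`triKernel_eq_triKernel'` holds. At $b=\sqrt2$ every 20V vertex has weight $1$ (`triKernel_rt2`).

Only the last column gets a general $b$. No path leaves it to the right, so each of its vertices
contributes $\sqrt2\,b-1$ if the vertical edge above it is occupied, and $1$ otherwise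
(`triKernel_of_empty`). The occupied vertical edges of this column form a segment starting at the
bottom, so refinement position $k$ gets weight $(\sqrt2\,b-1)^{k-1}$. In a six-vertex column with
$b=\sqrt2\,x$ the same argument gives $x^{k-1}$. Hence $\tau=2x-1$, that is $\sigma=x=(\tau+1)/2$.

In 20V₃ the diagonal lines start and end empty. The uppermost one is pushed by Yang–Baxter moves
above all row crossings of a column, where it meets the vertical line with both lines empty and the
crossing can be erased. Column after column, the line leaves the picture, and the next one can be
treated (`emptyProj_diagRows_colsOp_vacuum`, `colsOp_vacuum_apply`).

What remains is a triangular array of six-vertex crossings. With $m=N+n$ and $n\in\{N,N+1\}$, the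
leftmost $N$ columns and the lowest $N$ rows are frozen: every path there goes straight. Their
weights give the prefactor (`prod_colParam`), and the other crossings form an $n\times n$ square
with domain wall boundary conditions (`colsOp_zero_apply`). The sizes $2n$ and $2n-1$ are the cases
$N=n$ and $N=n-1$.

Partition functions and products of crossing operators are identified by `Node.prod_op_apply`:
columns are passed from left to right, each from bottom to top. The relations among the three 20V
models come from two affine involutions of the triangle, under which the ice rule is invariant
(`count2_eq_count3`, `count1_eq_count2`). -/

namespace VertexModel

/-- Functionals of the occupation numbers of a family of lines indexed by `Λ`. -/
abbrev LineFun (Λ : Type*) := (Λ → Bool) → ℂ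

/-! ### Crossing operators on functionals of the occupation numbers. -/

section Operators

variable {Λ : Type*} [DecidableEq Λ]

/-- The operator of a crossing of the lines `a` and `b`: the matrix `w` (rows: occupation numbers
before the crossing, columns: after it) acts on the bits of these two lines. -/
def R2 (a b : Λ) (w : Bool → Bool → Bool → Bool → ℂ) : Module.End ℂ (LineFun Λ) where
  toFun F s := ∑ x : Bool, ∑ y : Bool,
    w (s a) (s b) x y * F (Function.update (Function.update s a x) b y)
  map_add' F G := by
    funext s
    simp only [Pi.add_apply, mul_add, Finset.sum_add_distrib]
  map_smul' r F := by
    funext s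
    simp only [Pi.smul_apply, smul_eq_mul, Finset.mul_sum, RingHom.id_apply]
    refine Finset.sum_congr rfl fun x _ => Finset.sum_congr rfl fun y _ => by ring

/-- The operator of a vertex on three lines, with the matrix `w`. -/
def R3 (a b c : Λ) (w : Bool → Bool → Bool → Bool → Bool → Bool → ℂ) :
    Module.End ℂ (LineFun Λ) where
  toFun F s := ∑ x : Bool, ∑ y : Bool, ∑ z : Bool, w (s a) (s b) (s c) x y z *
    F (Function.update (Function.update (Function.update s a x) b y) c z)
  map_add' F G := by
    funext s
    simp only [Pi.add_apply, mul_add, Finset.sum_add_distrib]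
  map_smul' r F := by
    funext s
    simp only [Pi.smul_apply, smul_eq_mul, Finset.mul_sum, RingHom.id_apply]
    refine Finset.sum_congr rfl fun x _ => Finset.sum_congr rfl fun y _ =>
      Finset.sum_congr rfl fun z _ => by ring

/-- Multiplication by the function `φ` of the occupation numbers. -/
def mulOp (φ : LineFun Λ) : Module.End ℂ (LineFun Λ) where
  toFun F s := φ s * F s
  map_add' F G := by
    funext s
    simp only [Pi.add_apply, mul_add]
  map_smul' r F := by
    funext s
    simp only [Pi.smul_apply, smul_eq_mul, RingHom.id_apply]
    ring

theorem R2_apply (a b : Λ) (w : Bool → Bool → Bool → Bool → ℂ) (F : LineFun Λ) (s : Λ → Bool) :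
    R2 a b w F s = ∑ x : Bool, ∑ y : Bool,
      w (s a) (s b) x y * F (Function.update (Function.update s a x) b y) := rfl

theorem R3_apply (a b c : Λ) (w : Bool → Bool → Bool → Bool → Bool → Bool → ℂ) (F : LineFun Λ)
    (s : Λ → Bool) :
    R3 a b c w F s = ∑ x : Bool, ∑ y : Bool, ∑ z : Bool, w (s a) (s b) (s c) x y z *
      F (Function.update (Function.update (Function.update s a x) b y) c z) := rfl

theorem mulOp_apply (φ F : LineFun Λ) (s : Λ → Bool) : mulOp φ F s = φ s * F s := rfl

theorem commute_R2_R2 {a b c d : Λ} (hac : a ≠ c) (had : a ≠ d) (hbc : b ≠ c) (hbd : b ≠ d)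
    (w w' : Bool → Bool → Bool → Bool → ℂ) : Commute (R2 a b w) (R2 c d w') := by
  refine LinearMap.ext fun F => funext fun s => ?_
  have key : ∀ x y x' y', Function.update (Function.update
      (Function.update (Function.update s a x) b y) c x') d y' =
      Function.update (Function.update
      (Function.update (Function.update s c x') d y') a x) b y := by
    intro x y x' y'
    rw [Function.update_comm hbc, Function.update_comm hac, Function.update_comm hbd,
      Function.update_comm had]
  simp only [Module.End.mul_apply, R2_apply, key, Function.update_of_ne hac, Function.update_of_ne had,
    Function.update_of_ne hbc, Function.update_of_ne hbd, Function.update_of_ne hac.symm,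
    Function.update_of_ne had.symm, Function.update_of_ne hbc.symm, Function.update_of_ne hbd.symm,
    Fintype.sum_bool]
  ring

theorem commute_mulOp_R2 {a b : Λ} {φ : LineFun Λ}
    (hφ : ∀ s x y, φ (Function.update (Function.update s a x) b y) = φ s)
    (w : Bool → Bool → Bool → Bool → ℂ) : Commute (mulOp φ) (R2 a b w) := by
  refine LinearMap.ext fun F => funext fun s => ?_
  simp only [Module.End.mul_apply, R2_apply, mulOp_apply, hφ, Fintype.sum_bool]
  ring

/-- The multiplication by the indicator function of the line `l` being empty. -/
def emptyProj (l : Λ) : Module.End ℂ (LineFun Λ) := mulOp fun s => if s l then 0 else 1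

theorem emptyProj_apply (l : Λ) (F : LineFun Λ) (s : Λ → Bool) :
    emptyProj l F s = if s l then 0 else F s := by
  simp [emptyProj, mulOp_apply]

theorem commute_emptyProj_R2 {a b l : Λ} (ha : l ≠ a) (hb : l ≠ b)
    (w : Bool → Bool → Bool → Bool → ℂ) : Commute (emptyProj l) (R2 a b w) :=
  commute_mulOp_R2 (fun s x y => by
    rw [Function.update_of_ne hb, Function.update_of_ne ha]) w

/-- The kernel of three consecutive crossings `ab`, `cb`, `ac`. -/
def triKernel (u v w : Bool → Bool → Bool → Bool → ℂ) (h d t h' d' t' : Bool) : ℂ :=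
  ∑ x : Bool, ∑ y : Bool, ∑ z : Bool, u h t x y * v d y z t' * w x z h' d'

/-- The kernel of three consecutive crossings `ac`, `cb`, `ab`. -/
def triKernel' (u v w : Bool → Bool → Bool → Bool → ℂ) (h d t h' d' t' : Bool) : ℂ :=
  ∑ x : Bool, ∑ y : Bool, ∑ z : Bool, w h d x z * v z t d' y * u x y h' t'

/-- In a product the leftmost operator reads the given state first, so factors are listed in the
order in which crossings are passed. Composing kernels reduces operator identities for three lines
to finitely many scalar identities. -/
theorem R2_mul_R2_mul_R2 {a b c : Λ} (hab : a ≠ b) (hac : a ≠ c) (hbc : b ≠ c)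
    (u v w : Bool → Bool → Bool → Bool → ℂ) :
    R2 a b u * R2 c b v * R2 a c w = R3 a c b (triKernel u v w) := by
  refine LinearMap.ext fun F => funext fun s => ?_
  have key : ∀ x y z t h d, Function.update (Function.update (Function.update (Function.update
      (Function.update (Function.update s a x) b y) c z) b t) a h) c d =
      Function.update (Function.update (Function.update s a h) c d) b t := by
    intro x y z t h d
    funext l
    simp only [Function.update_apply]
    split_ifs <;> simp_all
  simp only [Module.End.mul_apply, R2_apply, R3_apply, triKernel, key, Function.update_self,
    Function.update_of_ne hab, Function.update_of_ne hac,
    Function.update_of_ne hac.symm, Function.update_of_ne hbc.symm,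
    Fintype.sum_bool]
  ring

theorem R2_mul_R2_mul_R2' {a b c : Λ} (hab : a ≠ b) (hac : a ≠ c) (hbc : b ≠ c)
    (u v w : Bool → Bool → Bool → Bool → ℂ) :
    R2 a c w * R2 c b v * R2 a b u = R3 a c b (triKernel' u v w) := by
  refine LinearMap.ext fun F => funext fun s => ?_
  have key : ∀ x y z t h d, Function.update (Function.update (Function.update (Function.update
      (Function.update (Function.update s a x) c y) c z) b t) a h) b d =
      Function.update (Function.update (Function.update s a h) c z) b d := by
    intro x y z t h d
    funext l
    simp only [Function.update_apply]
    split_ifs <;> simp_all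
  simp only [Module.End.mul_apply, R2_apply, R3_apply, triKernel', key, Function.update_self,
    Function.update_of_ne hab, Function.update_of_ne hac, Function.update_of_ne hbc,
    Function.update_of_ne hab.symm,
    Fintype.sum_bool]
  ring

end Operators

/-! ### The weights -/

/-- The square root of two. -/
noncomputable abbrev rt2 : ℂ := ((Real.sqrt 2 : ℝ) : ℂ)

theorem rt2_mul_self : rt2 * rt2 = 2 := by
  rw [rt2, ← Complex.ofReal_mul, Real.mul_self_sqrt (by norm_num)]
  norm_num

theorem rt2_ne_zero : rt2 ≠ 0 := by
  intro h
  have := rt2_mul_self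
  rw [h] at this
  norm_num at this

/-- The matrix of a crossing of a horizontal and a vertical line: before the crossing are the left
and the bottom edge, after it the right and the top edge. The weight of a straight path is `b`. -/
noncomputable def wHV (b : ℂ) : Bool → Bool → Bool → Bool → ℂ
  | false, false, false, false => 1
  | true, true, true, true => 1
  | true, false, true, false => b
  | false, true, false, true => b
  | true, true, false, false => 1
  | false, false, true, true => 1 - rt2 * b + b ^ 2
  | _, _, _, _ => 0

/-- The matrix of a crossing of a diagonal and a vertical line: before the crossing are the upper
left and the bottom edge. -/
noncomputable def wDV (b : ℂ) : Bool → Bool → Bool → Bool → ℂ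
  | false, false, false, false => 1
  | true, true, true, true => 1
  | true, false, true, false => rt2 - b⁻¹
  | false, true, false, true => rt2 - b⁻¹
  | true, true, false, false => b⁻¹
  | false, false, true, true => b⁻¹ - rt2 + b
  | _, _, _, _ => 0

/-- The matrix of a crossing of a horizontal and a diagonal line. -/
noncomputable def wHD : Bool → Bool → Bool → Bool → ℂ
  | false, false, false, false => 1
  | true, true, true, true => 1
  | true, false, true, false => rt2⁻¹
  | true, false, false, true => rt2⁻¹
  | false, true, true, false => rt2⁻¹
  | false, true, false, true => rt2⁻¹
  | _, _, _, _ => 0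

theorem rt2_inv_mul_two : rt2⁻¹ * 2 = rt2 := by
  rw [← rt2_mul_self, ← mul_assoc, inv_mul_cancel₀ rt2_ne_zero, one_mul]

set_option maxHeartbeats 2000000 in
/-- The Yang-Baxter equation. -/
theorem triKernel_eq_triKernel' {b : ℂ} (hb : b ≠ 0) :
    triKernel (wHV b) (wDV b) wHD = triKernel' (wHV b) (wDV b) wHD := by
  -- With these three relations, each of the 64 entries is a polynomial identity in $b$, $b^{-1}$,
  -- $\sqrt2$ and $\sqrt2^{-1}$.
  have h1 : b * b⁻¹ = 1 := mul_inv_cancel₀ hb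
  have h2 := rt2_inv_mul_two
  have h3 := rt2_mul_self
  funext h d t h' d' t'
  simp only [triKernel, triKernel', Fintype.sum_bool]
  cases h <;> cases d <;> cases t <;> cases h' <;> cases d' <;> cases t' <;>
    simp only [wHV, wDV, wHD, mul_zero, zero_mul, add_zero, zero_add, mul_one, one_mul] <;>
    generalize b⁻¹ = p at * <;> generalize rt2⁻¹ = q at * <;> generalize rt2 = r at * <;> grind

/-- The ice rule for three lines. -/
def triIce (h d t h' d' t' : Bool) : Prop :=
  h.toNat + d.toNat + t'.toNat = h'.toNat + d'.toNat + t.toNat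

instance (h d t h' d' t' : Bool) : Decidable (triIce h d t h' d' t') := by
  unfold triIce; infer_instance

set_option maxHeartbeats 2000000 in
/-- At the uniform point, all vertices of the 20V model have weight `1`. -/
theorem triKernel_rt2 (h d t h' d' t' : Bool) :
    triKernel (wHV rt2) (wDV rt2) wHD h d t h' d' t' = if triIce h d t h' d' t' then 1 else 0 := by
  have h1 := rt2_inv_mul_two
  have h2 := rt2_mul_self
  simp only [triKernel, Fintype.sum_bool]
  cases h <;> cases d <;> cases t <;> cases h' <;> cases d' <;> cases t' <;>
    simp only [wHV, wDV, wHD, mul_zero, zero_mul, add_zero, zero_add, mul_one, one_mul, triIce,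
      Bool.toNat_false, Bool.toNat_true, reduceIte, Nat.reduceAdd, Nat.reduceEqDiff,
      zero_ne_one, one_ne_zero] <;>
    generalize rt2⁻¹ = q at * <;> generalize rt2 = r at * <;> grind

set_option maxHeartbeats 1000000 in
/-- The weights of the 20V model on the last column, where no path leaves to the right. -/
theorem triKernel_of_empty {b : ℂ} (hb : b ≠ 0) (h d t t' : Bool) :
    triKernel (wHV b) (wDV b) wHD h d t false false t' =
      if triIce h d t false false t' then (if t' then rt2 * b - 1 else 1) else 0 := by
  have h1 : b * b⁻¹ = 1 := mul_inv_cancel₀ hb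
  have h2 := rt2_inv_mul_two
  have h3 := rt2_mul_self
  simp only [triKernel, Fintype.sum_bool]
  cases h <;> cases d <;> cases t <;> cases t' <;>
    simp only [wHV, wDV, wHD, mul_zero, zero_mul, add_zero, zero_add, mul_one, one_mul, triIce,
      Bool.toNat_false, Bool.toNat_true, reduceIte, Nat.reduceAdd, Nat.reduceEqDiff,
      zero_ne_one, one_ne_zero, Bool.false_eq_true] <;>
    generalize b⁻¹ = p at * <;> generalize rt2⁻¹ = q at * <;> generalize rt2 = r at * <;> grind


/-! ### Removing the diagonal lines -/

/-- The lines of the triangular lattice. -/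
abbrev Line := Fin 3 × ℕ

/-- The horizontal line in row `j`. -/
abbrev hL (j : ℕ) : Line := (0, j)

/-- The vertical line in column `-i`. -/
abbrev vL (i : ℕ) : Line := (1, i)

/-- The diagonal line through `(0, c)`. -/
abbrev dL (c : ℕ) : Line := (2, c)

section Columns

variable (β : ℕ → ℂ)

/-- The crossing of the column `-i` and the row `j`. -/
noncomputable def opHV (i j : ℕ) : Module.End ℂ (LineFun Line) := R2 (hL j) (vL i) (wHV (β i))

/-- The crossing of the column `-i` and the diagonal line `c`. -/
noncomputable def opDV (i c : ℕ) : Module.End ℂ (LineFun Line) := R2 (dL c) (vL i) (wDV (β i))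

/-- The crossing of the row `j` and the diagonal line `c`. -/
noncomputable def opHD (j c : ℕ) : Module.End ℂ (LineFun Line) := R2 (hL j) (dL c) wHD

/-- The vertex of the 20V model in column `-i` and on the diagonal line `c`. -/
noncomputable def opT (i c : ℕ) : Module.End ℂ (LineFun Line) :=
  opHV β i (i + c) * opDV β i c * opHD (i + c) c

theorem opT_eq_R3 (i c : ℕ) :
    opT β i c = R3 (hL (i + c)) (dL c) (vL i) (triKernel (wHV (β i)) (wDV (β i)) wHD) :=
  R2_mul_R2_mul_R2 (by simp) (by simp) (by simp) _ _ _

theorem opHD_mul_opDV_mul_opHV {i : ℕ} (hi : β i ≠ 0) (c j : ℕ) :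
    opHD j c * opDV β i c * opHV β i j = opHV β i j * opDV β i c * opHD j c := by
  have h1 : hL j ≠ vL i := by simp
  have h2 : hL j ≠ dL c := by simp
  have h3 : vL i ≠ dL c := by simp
  rw [opHD, opDV, opHV, R2_mul_R2_mul_R2 h1 h2 h3, R2_mul_R2_mul_R2' h1 h2 h3,
    triKernel_eq_triKernel' hi]

/-- The operator of the column `-i` of the triangle of size `m`, when only the first `C` diagonal
lines are present. -/
noncomputable def colOp (m C i : ℕ) : Module.End ℂ (LineFun Line) :=
  ((List.range (m - i)).map fun c => if c < C then opT β i c else opHV β i (i + c)).prod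

/-- The operator of the last `r` columns of the triangle of size `m`, when only the first `C`
diagonal lines are present. -/
noncomputable def colsOp (m C : ℕ) : ℕ → Module.End ℂ (LineFun Line)
  | 0 => 1
  | r + 1 => colOp β m C r * colsOp m C r

/-- The diagonal line `c` crosses the rows `a + n - 1, …, a`. -/
noncomputable def diagRows (c a : ℕ) : ℕ → Module.End ℂ (LineFun Line)
  | 0 => 1
  | n + 1 => opHD (a + n) c * diagRows c a n

/-- Splits off the last crossing, with the lowest row, instead of the first one; in the removal of a
line this is the crossing that belongs to a 20V vertex. -/
theorem diagRows_succ' (c a n : ℕ) :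
    diagRows c a (n + 1) = diagRows c (a + 1) n * opHD a c := by
  induction n with
  | zero => simp [diagRows]
  | succ n ih =>
    rw [diagRows, ih, diagRows, mul_assoc, show a + (n + 1) = a + 1 + n by ring]

/-- An operator commutes with a product along the diagonal line `c`. -/
theorem commute_diagRows {X : Module.End ℂ (LineFun Line)} {c a n : ℕ}
    (h : ∀ k < n, Commute X (opHD (a + k) c)) : Commute X (diagRows c a n) := by
  induction n with
  | zero => exact Commute.one_right X
  | succ n ih =>
    exact (h n (by omega)).mul_right (ih fun k hk => h k (by omega))

theorem commute_list_prod {X : Module.End ℂ (LineFun Line)} {n : ℕ}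
    {f : ℕ → Module.End ℂ (LineFun Line)} (h : ∀ k < n, Commute X (f k)) :
    Commute X ((List.range n).map f).prod := by
  refine Commute.list_prod_right _ _ fun Y hY => ?_
  obtain ⟨k, hk, rfl⟩ := List.mem_map.1 hY
  exact h k (List.mem_range.1 hk)

/-- One Yang–Baxter move per row slides the diagonal line across a segment of the column. Before, it
meets the rows to the left of the column and then the column below the segment; afterwards, the
column above the segment and then the rows to its right. -/
theorem diagRows_mul_opDV_mul {i : ℕ} (hi : β i ≠ 0) (c a n : ℕ) :
    diagRows c a n * opDV β i c * ((List.range n).map fun k => opHV β i (a + k)).prod =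
      ((List.range n).map fun k => opHV β i (a + k)).prod * opDV β i c * diagRows c a n := by
  induction n with
  | zero => simp [diagRows]
  | succ n ih =>
    rw [List.range_succ, List.map_append, List.prod_append, List.map_singleton,
      List.prod_singleton, diagRows]
    set U := ((List.range n).map fun k => opHV β i (a + k)).prod
    have c1 : Commute (opHD (a + n) c) U := commute_list_prod fun k hk =>
      commute_R2_R2 (by simp; omega) (by simp) (by simp) (by simp) _ _
    have c2 : Commute (opHV β i (a + n)) (diagRows c a n) := commute_diagRows fun k hk =>
      commute_R2_R2 (by simp; omega) (by simp) (by simp) (by simp) _ _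
    calc opHD (a + n) c * diagRows c a n * opDV β i c * (U * opHV β i (a + n))
        = opHD (a + n) c * (diagRows c a n * opDV β i c * U) * opHV β i (a + n) := by
          simp only [mul_assoc]
      _ = (opHD (a + n) c * U) * opDV β i c * (diagRows c a n * opHV β i (a + n)) := by
          rw [ih]; simp only [mul_assoc]
      _ = U * (opHD (a + n) c * opDV β i c * opHV β i (a + n)) * diagRows c a n := by
          rw [c1.eq, ← c2.eq]; simp only [mul_assoc]
      _ = _ := by
          rw [opHD_mul_opDV_mul_opHV β hi]; simp only [mul_assoc]

/-- The indicator function of the lines of index `< m` being empty. -/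
noncomputable def vacuum (m : ℕ) : LineFun Line := fun s =>
  if ∀ t : Fin 3, ∀ k < m, s (t, k) = false then 1 else 0

theorem vacuum_eq_zero {m : ℕ} {s : Line → Bool} {l : Line} (hl : l.2 < m) (h : s l = true) :
    vacuum m s = 0 := by
  rw [vacuum, if_neg]
  intro h'
  rw [h' l.1 l.2 hl] at h
  exact Bool.noConfusion h

theorem update_update_eq_self {s : Line → Bool} {a b : Line} {x y : Bool} (ha : s a = x)
    (hb : s b = y) : Function.update (Function.update s a x) b y = s := by
  subst ha hb
  simp

/-- The crossing conserves the number of occupied lines and has weight $1$ on empty lines, so it may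
be added or dropped where all lines end empty. -/
theorem opHD_vacuum {m j c : ℕ} (hj : j < m) (hc : c < m) :
    opHD j c (vacuum m) = vacuum m := by
  funext s
  have h1 : ∀ x, vacuum m (Function.update (Function.update s (hL j) x) (dL c) true) = 0 :=
    fun x => vacuum_eq_zero (l := dL c) hc (by simp)
  have h2 : ∀ x, vacuum m (Function.update (Function.update s (hL j) true) (dL c) x) = 0 :=
    fun x => vacuum_eq_zero (l := hL j) hj (by simp)
  simp only [opHD, R2_apply, Fintype.sum_bool, h1, h2, mul_zero, zero_add]
  rcases hsj : s (hL j) with - | -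
  · rcases hsc : s (dL c) with - | -
    · rw [wHD, one_mul, update_update_eq_self hsj hsc]
    · simp [wHD, vacuum_eq_zero (l := dL c) hc hsc]
  · rw [vacuum_eq_zero (l := hL j) hj hsj]
    rcases s (dL c) with - | - <;> simp [wHD]

theorem diagRows_vacuum {m c a n : ℕ} (ha : a + n ≤ m) (hc : c < m) :
    diagRows c a n (vacuum m) = vacuum m := by
  induction n with
  | zero => rfl
  | succ n ih =>
    rw [diagRows, Module.End.mul_apply, ih (by omega), opHD_vacuum (by omega) hc]

/-- A diagonal line enters empty and crosses a vertical line that leaves empty. -/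
theorem emptyProj_mul_opDV_mul_emptyProj (i c : ℕ) :
    emptyProj (dL c) * opDV β i c * emptyProj (vL i) = emptyProj (dL c) * emptyProj (vL i) := by
  refine LinearMap.ext fun F => funext fun s => ?_
  simp only [Module.End.mul_apply, emptyProj_apply, opDV, R2_apply, Fintype.sum_bool,
    Function.update_self, if_true, mul_zero, zero_add, Bool.false_eq_true, if_false]
  rcases hsc : s (dL c) with - | -
  · rcases hsi : s (vL i) with - | -
    · simp only [wDV, one_mul, update_update_eq_self hsc hsi]
      simp
    · simp [wDV]
  · simp

theorem commute_emptyProj_opT {l : Line} {i c : ℕ} (h1 : l ≠ hL (i + c)) (h2 : l ≠ vL i)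
    (h3 : l ≠ dL c) : Commute (emptyProj l) (opT β i c) :=
  ((commute_emptyProj_R2 h1 h2 _).mul_right (commute_emptyProj_R2 h3 h2 _)).mul_right
    (commute_emptyProj_R2 h1 h3 _)

theorem commute_emptyProj_colOp {l : Line} {m C i : ℕ} (h1 : ∀ j, l ≠ hL j) (h2 : l ≠ vL i)
    (h3 : ∀ c < C, l ≠ dL c) : Commute (emptyProj l) (colOp β m C i) := by
  refine commute_list_prod fun k _ => ?_
  split_ifs with hk
  · exact commute_emptyProj_opT β (h1 _) h2 (h3 k hk)
  · exact commute_emptyProj_R2 (h1 _) h2 _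

theorem commute_emptyProj_colsOp {l : Line} {m C r : ℕ} (h1 : ∀ j, l ≠ hL j)
    (h2 : ∀ i < r, l ≠ vL i) (h3 : ∀ c < C, l ≠ dL c) :
    Commute (emptyProj l) (colsOp β m C r) := by
  induction r with
  | zero => exact Commute.one_right _
  | succ r ih =>
    exact (commute_emptyProj_colOp β h1 (h2 r (by omega)) h3).mul_right
      (ih fun i hi => h2 i (by omega))

theorem emptyProj_vacuum {m : ℕ} {l : Line} (hl : l.2 < m) :
    emptyProj l (vacuum m) = vacuum m := by
  funext s
  rw [emptyProj_apply]
  split_ifs with h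
  · rw [vacuum_eq_zero hl h]
  · rfl

/-- The vertices of a column below, on, and above the diagonal line `C`. -/
theorem colOp_split {m C i : ℕ} (h : i + C < m) (K : ℕ) (hK : K = C ∨ K = C + 1) :
    colOp β m K i = ((List.range C).map fun c => opT β i c).prod *
      ((if K = C then opHV β i (i + C) else opT β i C) *
      ((List.range (m - i - C - 1)).map fun k => opHV β i (i + C + 1 + k)).prod) := by
  have e : m - i = C + (1 + (m - i - C - 1)) := by omega
  rw [colOp, e, List.range_add, List.map_append, List.prod_append, List.range_add, List.map_append,
    List.map_append, List.prod_append, Nat.add_sub_cancel_left, Nat.add_sub_cancel_left]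
  congr 1
  · congr 1
    refine List.map_congr_left fun c hc => ?_
    rw [if_pos]
    have := List.mem_range.1 hc
    omega
  · congr 1
    · rcases hK with rfl | rfl <;> simp
    · rw [List.map_map, List.map_map]
      congr 1
      refine List.map_congr_left fun c _ => ?_
      simp only [Function.comp]
      rw [if_neg (by omega)]
      congr 1
      ring

/-- Here line `C` first descends through the rows from the top to row `r + C`, just left of the last
`r` columns, and then follows its usual course. Sliding it over the leftmost of these columns moves
their crossing to the top of the column. There the diagonal line is still empty and the vertical
line ends empty, so the crossing disappears, and the line descends one column further to the right.
Past the last column it meets empty lines only. -/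
theorem emptyProj_diagRows_colsOp_vacuum (hβ : ∀ i, β i ≠ 0) {m C r : ℕ} (hr : r + C ≤ m)
    (hC : C < m) :
    (emptyProj (dL C) * diagRows C (r + C) (m - r - C) * colsOp β m (C + 1) r) (vacuum m) =
      (emptyProj (dL C) * colsOp β m C r) (vacuum m) := by
  induction r with
  | zero =>
    simp only [colsOp, mul_one, Module.End.mul_apply]
    rw [diagRows_vacuum (by omega) hC]
  | succ r ih =>
    obtain ⟨n, hn⟩ : ∃ n, m - (r + 1) - C = n := ⟨_, rfl⟩
    have hn' : m - r - C - 1 = n := by omega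
    have hn'' : m - r - C = n + 1 := by omega
    specialize ih (by omega)
    rw [hn'', diagRows_succ'] at ih
    rw [hn, colsOp, colsOp, colOp_split β (by omega) (C + 1) (Or.inr rfl),
      colOp_split β (by omega) C (Or.inl rfl), if_neg (by omega), if_pos rfl, hn', opT,
      show r + 1 + C = r + C + 1 by ring]
    set L := ((List.range C).map fun c => opT β r c).prod
    set U := ((List.range n).map fun k => opHV β r (r + C + 1 + k)).prod with hU
    set R := diagRows C (r + C + 1) n
    set P := colsOp β m (C + 1) r
    set P' := colsOp β m C r
    have cRL : Commute R L := by
      refine (commute_diagRows fun k hk => ?_).symm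
      refine (commute_list_prod fun c hc => ?_).symm
      refine (Commute.mul_right ?_ ?_).mul_right ?_
      · exact commute_R2_R2 (by simp; omega) (by simp) (by simp) (by simp) _ _
      · exact commute_R2_R2 (by simp) (by simp) (by simp; omega) (by simp) _ _
      · exact commute_R2_R2 (by simp; omega) (by simp) (by simp) (by simp; omega) _ _
    have cRH : Commute R (opHV β r (r + C)) :=
      (commute_diagRows fun k hk =>
        commute_R2_R2 (by simp; omega) (by simp) (by simp) (by simp) _ _).symm
    have cDU : Commute (opHD (r + C) C) U := commute_list_prod fun k hk =>
      commute_R2_R2 (by simp; omega) (by simp) (by simp) (by simp) _ _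
    have cEL : Commute (emptyProj (dL C)) L := commute_list_prod fun c hc =>
      commute_emptyProj_opT β (by simp) (by simp) (by simp; omega)
    have cEH : Commute (emptyProj (dL C)) (opHV β r (r + C)) :=
      commute_emptyProj_R2 (by simp) (by simp) _
    have cEU : Commute (emptyProj (dL C)) U := commute_list_prod fun k hk =>
      commute_emptyProj_R2 (by simp) (by simp) _
    have cQR : Commute (emptyProj (vL r)) (R * opHD (r + C) C) :=
      (commute_diagRows fun k hk => commute_emptyProj_R2 (by simp) (by simp) _).mul_right
        (commute_emptyProj_R2 (by simp) (by simp) _)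
    have cQP : Commute (emptyProj (vL r)) P :=
      commute_emptyProj_colsOp β (by simp) (fun i hi => by simp; omega) (by simp)
    have ybe : R * opDV β r C * U = U * opDV β r C * R := diagRows_mul_opDV_mul β (hβ r) C _ n
    have hQ : emptyProj (vL r) (vacuum m) = vacuum m := emptyProj_vacuum (by simp; omega)
    -- The commutations assemble the Yang–Baxter configuration `R`, `opDV`, `U`; after the slide,
    -- the empty projection is moved next to the crossing of line `C` with the column.
    have e1 : emptyProj (dL C) * R * (L * (opHV β r (r + C) * opDV β r C * opHD (r + C) C * U) * P)
        = L * opHV β r (r + C) * U * (emptyProj (dL C) * opDV β r C * (R * opHD (r + C) C * P)) := by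
      calc _ = emptyProj (dL C) * (R * L) * opHV β r (r + C) * opDV β r C *
            (opHD (r + C) C * U) * P := by simp only [mul_assoc]
        _ = (emptyProj (dL C) * L) * (R * opHV β r (r + C)) * opDV β r C * U *
            opHD (r + C) C * P := by rw [cRL.eq, cDU.eq]; simp only [mul_assoc]
        _ = L * (emptyProj (dL C) * opHV β r (r + C)) * (R * opDV β r C * U) *
            opHD (r + C) C * P := by rw [cEL.eq, cRH.eq]; simp only [mul_assoc]
        _ = L * opHV β r (r + C) * (emptyProj (dL C) * U) * opDV β r C * R *
            opHD (r + C) C * P := by rw [cEH.eq, ybe]; simp only [mul_assoc]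
        _ = _ := by rw [cEU.eq]; simp only [mul_assoc]
    -- The vertical line `r` is untouched after this crossing, so its emptiness in the final vacuum
    -- can be transported back to just behind the crossing.
    have e2 : (emptyProj (dL C) * opDV β r C * (R * opHD (r + C) C * P)) (vacuum m) =
        (emptyProj (dL C) * P') (vacuum m) := by
      have : (R * opHD (r + C) C * P) (vacuum m) =
          emptyProj (vL r) ((R * opHD (r + C) C * P) (vacuum m)) := by
        conv_lhs => rw [← hQ, ← Module.End.mul_apply, ← (cQR.mul_right cQP).eq]
        rfl
      rw [Module.End.mul_apply, this, ← Module.End.mul_apply, emptyProj_mul_opDV_mul_emptyProj,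
        Module.End.mul_apply, ← this, ← Module.End.mul_apply, ← ih]
      simp only [mul_assoc]
    rw [e1, Module.End.mul_apply, e2, ← Module.End.mul_apply]
    congr 1
    calc _ = L * (opHV β r (r + C)) * (U * emptyProj (dL C)) * P' := by simp only [mul_assoc]
      _ = L * (opHV β r (r + C) * emptyProj (dL C)) * U * P' := by
        rw [← cEU.eq]; simp only [mul_assoc]
      _ = (L * emptyProj (dL C)) * opHV β r (r + C) * U * P' := by
        rw [← cEH.eq]; simp only [mul_assoc]
      _ = _ := by rw [← cEL.eq]; simp only [mul_assoc]

/-- Line `C` enters the triangle in column $-(m-1-C)$ and does not meet the columns further left. -/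
theorem colOp_succ_of_le {m C i : ℕ} (h : m ≤ i + C) : colOp β m (C + 1) i = colOp β m C i := by
  rw [colOp, colOp]
  congr 1
  refine List.map_congr_left fun c hc => ?_
  have := List.mem_range.1 hc
  rw [if_pos (by omega), if_pos (by omega)]

theorem emptyProj_colsOp_vacuum (hβ : ∀ i, β i ≠ 0) {m C r : ℕ} (hC : C < m) (hr : m ≤ r + C) :
    (emptyProj (dL C) * colsOp β m (C + 1) r) (vacuum m) =
      (emptyProj (dL C) * colsOp β m C r) (vacuum m) := by
  induction r, (show m - C ≤ r by omega) using Nat.le_induction with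
  | base =>
    -- For $r=m-C$ the line enters right at the top of its first column, so no additional row
    -- crossings are left.
    have := emptyProj_diagRows_colsOp_vacuum β hβ (r := m - C) (by omega) hC
    rw [show m - (m - C) - C = 0 by omega, diagRows, mul_one] at this
    exact this
  | succ r hr' ih =>
    have c1 : Commute (emptyProj (dL C)) (colOp β m C r) :=
      commute_emptyProj_colOp β (by simp) (by simp) (fun c hc => by simp; omega)
    rw [colsOp, colsOp, colOp_succ_of_le β (by omega), ← mul_assoc, ← mul_assoc, c1.eq, mul_assoc,
      mul_assoc, Module.End.mul_apply, ih (by omega), ← Module.End.mul_apply]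

/-- The diagonal lines can be removed from the triangle. -/
theorem colsOp_vacuum_apply (hβ : ∀ i, β i ≠ 0) {m C : ℕ} (hC : C ≤ m) {s : Line → Bool}
    (hs : ∀ c, s (dL c) = false) :
    colsOp β m C m (vacuum m) s = colsOp β m 0 m (vacuum m) s := by
  induction C with
  | zero => rfl
  | succ C ih =>
    -- The uppermost remaining diagonal line is the one removed: above it, a column has crossings
    -- with rows only, as the sliding requires.
    rw [← ih (by omega)]
    have := congrFun (emptyProj_colsOp_vacuum β hβ (r := m) (show C < m by omega) (by omega)) s
    simpa only [Module.End.mul_apply, emptyProj_apply, hs, Bool.false_eq_true, if_false] using this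

end Columns

/-! ### The frozen regions of the triangle -/

section Frozen

variable (β : ℕ → ℂ)

/-- By the ice rule the difference of the two occupation numbers is conserved; if it is $\pm1$, both
paths of the evolution are forced straight. -/
theorem opHV_apply_of_ne {i j : ℕ} {s : Line → Bool} (h : s (hL j) ≠ s (vL i)) (F : LineFun Line) :
    opHV β i j F s = β i * F s := by
  rcases hj : s (hL j) with - | - <;> rcases hi : s (vL i) with - | -
  · simp [hj, hi] at h
  · simp only [opHV, R2_apply, Fintype.sum_bool, hj, hi, wHV, zero_mul, add_zero, zero_add,
      update_update_eq_self hj hi]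
  · simp only [opHV, R2_apply, Fintype.sum_bool, hj, hi, wHV, zero_mul, add_zero, zero_add,
      update_update_eq_self hj hi]
  · simp [hj, hi] at h

/-- The operator of the crossings of the column `-i` with the rows `a, …, a + K - 1`. -/
noncomputable def opColumn (i a K : ℕ) : Module.End ℂ (LineFun Line) :=
  ((List.range K).map fun k => opHV β i (a + k)).prod

theorem opColumn_add (i a K K' : ℕ) :
    opColumn β i a (K + K') = opColumn β i a K * opColumn β i (a + K) K' := by
  rw [opColumn, List.range_add, List.map_append, List.prod_append, List.map_map]
  congr 2
  refine List.map_congr_left fun c _ => ?_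
  simp [add_assoc]

theorem opColumn_apply_of_ne {i a K : ℕ} {s : Line → Bool}
    (h : ∀ k < K, s (hL (a + k)) ≠ s (vL i)) (F : LineFun Line) :
    opColumn β i a K F s = β i ^ K * F s := by
  induction K generalizing F with
  | zero => simp [opColumn]
  | succ K ih =>
    rw [opColumn_add, Module.End.mul_apply, ih fun k hk => h k (by omega)]
    simp only [opColumn, List.range_one, List.map_cons, List.map_nil, List.prod_singleton, add_zero]
    rw [opHV_apply_of_ne β (h K (by omega))]
    ring

theorem colOp_zero (m i : ℕ) : colOp β m 0 i = opColumn β i i (m - i) := by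
  simp [colOp, opColumn]

/-- The operator of the crossings of the last `r` columns with the rows `N, …, N + n - 1`. -/
noncomputable def squareOp (N n : ℕ) : ℕ → Module.End ℂ (LineFun Line)
  | 0 => 1
  | r + 1 => opColumn β r N n * squareOp N n r

/-- The indicator function of the rows below `N` being empty, and the last `r` columns occupied. -/
noncomputable def bottomFun (N r : ℕ) : LineFun Line := fun s =>
  if (∀ j < N, s (hL j) = false) ∧ ∀ i < r, s (vL i) = true then 1 else 0

theorem bottomFun_update {N r i j : ℕ} (hi : r ≤ i) (hj : N ≤ j) (s : Line → Bool) (x y : Bool) :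
    bottomFun N r (Function.update (Function.update s (hL j) x) (vL i) y) = bottomFun N r s := by
  have h1 : ∀ k < N, Function.update (Function.update s (hL j) x) (vL i) y (hL k) = s (hL k) := by
    intro k hk
    rw [Function.update_of_ne (by simp), Function.update_of_ne (by simp; omega)]
  have h2 : ∀ k < r, Function.update (Function.update s (hL j) x) (vL i) y (vL k) = s (vL k) := by
    intro k hk
    rw [Function.update_of_ne (by simp; omega), Function.update_of_ne (by simp)]
  unfold bottomFun
  congr 1
  refine propext (and_congr ?_ ?_)
  · exact forall₂_congr fun k hk => by rw [h1 k hk]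
  · exact forall₂_congr fun k hk => by rw [h2 k hk]

/-- An occupied column crosses the empty rows below `N` without interaction, which leaves those rows
empty for the next column. The crossings with rows from `N` on do not touch the lines that
`bottomFun` looks at, so the constraint passes through them. The exponent is $0$ in column $-N$,
which occurs when $n=N+1$. -/
theorem mulOp_bottomFun_colsOp {N n m r : ℕ} (hm : m = N + n) (hr : r ≤ N + 1) :
    mulOp (bottomFun N r) * colsOp β m 0 r =
      (∏ i ∈ Finset.range r, β i ^ (N - i)) • (mulOp (bottomFun N r) * squareOp β N n r) := by
  induction r with
  | zero => simp [colsOp, squareOp]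
  | succ r ih =>
    specialize ih (by omega)
    have c1 : Commute (mulOp (bottomFun N r)) (opColumn β r N n) := commute_list_prod fun k _ =>
      commute_mulOp_R2 (bottomFun_update le_rfl (by omega)) _
    have e0 : ∀ s, bottomFun N (r + 1) s = bottomFun N (r + 1) s * bottomFun N r s := by
      intro s
      unfold bottomFun
      split_ifs with h h'
      · simp
      · exact absurd ⟨h.1, fun i hi => h.2 i (by omega)⟩ h'
      all_goals simp
    have e1 : mulOp (bottomFun N (r + 1)) = mulOp (bottomFun N (r + 1)) * mulOp (bottomFun N r) := by
      refine LinearMap.ext fun F => funext fun s => ?_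
      simp only [Module.End.mul_apply, mulOp_apply]
      rw [← mul_assoc, ← e0]
    have e2 : mulOp (bottomFun N (r + 1)) * opColumn β r r (N - r) =
        β r ^ (N - r) • mulOp (bottomFun N (r + 1)) := by
      refine LinearMap.ext fun F => funext fun s => ?_
      simp only [Module.End.mul_apply, mulOp_apply, LinearMap.smul_apply, Pi.smul_apply, smul_eq_mul]
      by_cases h : (∀ j < N, s (hL j) = false) ∧ ∀ i < r + 1, s (vL i) = true
      · rw [opColumn_apply_of_ne β fun k hk => ?_]
        · ring
        · rw [h.1 _ (by omega), h.2 _ (by omega)]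
          simp
      · rw [bottomFun, if_neg h]
        ring
    have e3 : colOp β m 0 r = opColumn β r r (N - r) * opColumn β r N n := by
      rw [colOp_zero, show m - r = (N - r) + n by omega, opColumn_add,
        show r + (N - r) = N by omega]
    calc _ = (mulOp (bottomFun N (r + 1)) * opColumn β r r (N - r)) * opColumn β r N n *
          colsOp β m 0 r := by rw [colsOp, e3]; simp only [mul_assoc]
      _ = β r ^ (N - r) • (mulOp (bottomFun N (r + 1)) *
          (mulOp (bottomFun N r) * opColumn β r N n) * colsOp β m 0 r) := by
          rw [e2, ← mul_assoc (mulOp (bottomFun N (r + 1))), ← e1]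
          simp only [smul_mul_assoc]
      _ = β r ^ (N - r) • (mulOp (bottomFun N (r + 1)) * opColumn β r N n *
          (mulOp (bottomFun N r) * colsOp β m 0 r)) := by
          rw [c1.eq]; simp only [mul_assoc]
      _ = (∏ i ∈ Finset.range (r + 1), β i ^ (N - i)) • (mulOp (bottomFun N (r + 1)) *
          (opColumn β r N n * mulOp (bottomFun N r)) * squareOp β N n r) := by
          rw [ih, Finset.prod_range_succ, mul_comm, mul_smul]
          simp only [mul_smul_comm, mul_assoc]
      _ = _ := by
          rw [← c1.eq, ← mul_assoc, ← e1, squareOp]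
          simp only [mul_assoc]

/-- The triangle without diagonal lines consists of two frozen triangles and a square. -/
theorem colsOp_zero_apply {N n m : ℕ} (hm : m = N + n) (h1 : N ≤ n) (h2 : n ≤ N + 1)
    {s : Line → Bool} (hH : ∀ j < m, s (hL j) = decide (N ≤ j))
    (hV : ∀ i < m, s (vL i) = decide (i < n)) (F : LineFun Line) :
    colsOp β m 0 m F s = (∏ i ∈ Finset.Ico n m, β i ^ (m - i)) *
      (∏ i ∈ Finset.range n, β i ^ (N - i)) * squareOp β N n n F s := by
  -- The left frozen triangle: an empty column here meets only rows $j\ge n\ge N$, which are all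
  -- occupied.
  have key : ∀ r, n ≤ r → r ≤ m → colsOp β m 0 r F s =
      (∏ i ∈ Finset.Ico n r, β i ^ (m - i)) * colsOp β m 0 n F s := by
    intro r hr
    induction r, hr using Nat.le_induction with
    | base => simp
    | succ r hr ih =>
      intro hrm
      rw [colsOp, Module.End.mul_apply, colOp_zero, opColumn_apply_of_ne β, ih (by omega),
        Finset.prod_Ico_succ_top hr]
      · ring
      · intro k hk
        rw [hH _ (by omega), hV _ (by omega), decide_eq_true (by omega), decide_eq_false (by omega)]
        simp
  have h3 : bottomFun N n s = 1 := by
    rw [bottomFun, if_pos]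
    refine ⟨fun j hj => ?_, fun i hi => ?_⟩
    · rw [hH j (by omega), decide_eq_false (by omega)]
    · rw [hV i (by omega), decide_eq_true (by omega)]
  have h4 := congrFun (LinearMap.congr_fun (mulOp_bottomFun_colsOp β hm h2) F) s
  simp only [Module.End.mul_apply, mulOp_apply, h3, one_mul, LinearMap.smul_apply, Pi.smul_apply,
    smul_eq_mul] at h4
  rw [key m (by omega) le_rfl, h4, mul_assoc]

end Frozen

/-! ### State sums as products of operators -/

/-- A vertex of a system of lines `Λ` with edges in `E`: the lines through the vertex, the edges of
these lines before and after the vertex, and its weight as a function of the occupation numbers. -/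
structure Node (Λ E : Type*) where
  /-- The lines through the vertex. -/
  lines : Finset Λ
  /-- The edge of a line before the vertex. -/
  bef : Λ → E
  /-- The edge of a line after the vertex. -/
  aft : Λ → E
  /-- The weight. -/
  ker : (Λ → Bool) → (Λ → Bool) → ℂ

namespace Node

variable {Λ E : Type*} [DecidableEq Λ] [DecidableEq E]

/-- The edges after a vertex. -/
def after (N : Node Λ E) : Finset E := N.lines.image N.aft

/-- The edges before a vertex. -/
def before (N : Node Λ E) : Finset E := N.lines.image N.bef

/-- The weight of a vertex in the configuration with occupied edges `A`. -/
noncomputable def wt (N : Node Λ E) (A : Finset E) : ℂ :=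
  N.ker (fun l => decide (N.bef l ∈ A)) (fun l => decide (N.aft l ∈ A))

/-- The operator of a vertex. -/
noncomputable def op (N : Node Λ E) : Module.End ℂ (LineFun Λ) where
  toFun F s := ∑ X ∈ N.lines.powerset, N.ker s (fun l => decide (l ∈ X)) *
    F (fun l => if l ∈ N.lines then decide (l ∈ X) else s l)
  map_add' F G := by
    funext s
    simp only [Pi.add_apply, mul_add, Finset.sum_add_distrib]
  map_smul' r F := by
    funext s
    simp only [Pi.smul_apply, smul_eq_mul, Finset.mul_sum, RingHom.id_apply]
    exact Finset.sum_congr rfl fun X _ => by ring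

/-- The weight only depends on the lines through the vertex, whose edges are distinct. -/
structure Good (N : Node Λ E) : Prop where
  ker_congr : ∀ s s' t t', (∀ l ∈ N.lines, s l = s' l) → (∀ l ∈ N.lines, t l = t' l) →
    N.ker s t = N.ker s' t'
  inj : Set.InjOn N.aft N.lines
  disj : Disjoint N.before N.after

/-- `Adv L f g`: when the vertices of `L` are passed one after the other, the current edges of the
lines change from `f` to `g`. -/
def Adv : List (Node Λ E) → (Λ → E) → (Λ → E) → Prop
  | [], f, g => f = g
  | N :: L, f, g => (∀ l ∈ N.lines, f l = N.bef l) ∧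
      Adv L (fun l => if l ∈ N.lines then N.aft l else f l) g

theorem Adv.append {L L' : List (Node Λ E)} {f g h : Λ → E} (h1 : Adv L f g) (h2 : Adv L' g h) :
    Adv (L ++ L') f h := by
  induction L generalizing f with
  | nil => rw [Adv] at h1; subst h1; exact h2
  | cons N L ih => exact ⟨h1.1, ih h1.2⟩

/-- The edges after the vertices of a list. -/
def afterAll : List (Node Λ E) → Finset E
  | [] => ∅
  | N :: L => N.after ∪ afterAll L

theorem mem_afterAll {L : List (Node Λ E)} {e : E} : e ∈ afterAll L ↔ ∃ N ∈ L, e ∈ N.after := by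
  induction L with
  | nil => simp [afterAll]
  | cons N L ih => simp [afterAll, ih]

theorem sum_powerset_union {P Q : Finset E} (h : Disjoint P Q) (f : Finset E → ℂ) :
    ∑ X ∈ (P ∪ Q).powerset, f X = ∑ X ∈ P.powerset, ∑ Y ∈ Q.powerset, f (X ∪ Y) := by
  rw [← Finset.sum_product']
  symm
  refine Finset.sum_nbij' (fun p => p.1 ∪ p.2) (fun X => (X ∩ P, X ∩ Q)) ?_ ?_ ?_ ?_ ?_
  · intro p hp
    simp only [Finset.mem_product, Finset.mem_powerset] at hp ⊢
    exact Finset.union_subset_union hp.1 hp.2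
  · intro X _
    simp only [Finset.mem_product, Finset.mem_powerset]
    exact ⟨Finset.inter_subset_right, Finset.inter_subset_right⟩
  · rintro ⟨X, Y⟩ hp
    simp only [Finset.mem_product, Finset.mem_powerset] at hp
    ext1
    · ext e
      simp only [Finset.mem_inter, Finset.mem_union]
      have := fun he : e ∈ P => Finset.disjoint_left.1 h he
      have := @hp.1 e
      have := @hp.2 e
      tauto
    · ext e
      simp only [Finset.mem_inter, Finset.mem_union]
      have := fun he : e ∈ P => Finset.disjoint_left.1 h he
      have := @hp.1 e
      have := @hp.2 e
      tauto
  · intro X hX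
    simp only [Finset.mem_powerset] at hX
    simp only [← Finset.inter_union_distrib_left]
    exact Finset.inter_eq_left.2 hX
  · intro p _
    rfl

theorem sum_powerset_after {N : Node Λ E} (hN : N.Good) (f : Finset E → ℂ) :
    ∑ Y ∈ N.after.powerset, f Y = ∑ X ∈ N.lines.powerset, f (X.image N.aft) := by
  symm
  refine Finset.sum_bij (fun X _ => X.image N.aft) ?_ ?_ ?_ ?_
  · intro X hX
    exact Finset.mem_powerset.2 (Finset.image_subset_image (Finset.mem_powerset.1 hX))
  · intro X hX Y hY h
    have hX' := Finset.mem_powerset.1 hX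
    have hY' := Finset.mem_powerset.1 hY
    refine Finset.coe_injective ((hN.inj.image_eq_image_iff ?_ ?_).1 ?_)
    · exact_mod_cast hX'
    · exact_mod_cast hY'
    · exact_mod_cast h
  · intro Y hY
    obtain ⟨X, hX, rfl⟩ := Finset.subset_image_iff.1 (Finset.mem_powerset.1 hY)
    exact ⟨X, Finset.mem_powerset.2 (by exact_mod_cast hX), rfl⟩
  · intro X _
    rfl

/-- A product of vertex operators is a state sum over the configurations of the edges after these
vertices. -/
theorem prod_op_apply {L : List (Node Λ E)} {f g : Λ → E} {A : Finset E} (F : LineFun Λ)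
    (hadv : Adv L f g) (hgood : ∀ N ∈ L, N.Good)
    (hpair : L.Pairwise fun N N' => Disjoint N'.after (N.before ∪ N.after))
    (hA : ∀ N ∈ L, Disjoint A N.after) (hf : ∀ N ∈ L, ∀ l, f l ∉ N.after) :
    (L.map op).prod F (fun l => decide (f l ∈ A)) =
      ∑ X ∈ (afterAll L).powerset, (L.map fun N => N.wt (A ∪ X)).prod *
        F (fun l => decide (g l ∈ A ∪ X)) := by
  induction L generalizing f A with
  | nil =>
    rw [Adv] at hadv
    subst hadv
    simp [afterAll]
  | cons N L ih =>
    obtain ⟨hb, hadv⟩ := hadv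
    rw [List.pairwise_cons] at hpair
    have hN := hgood N (List.mem_cons_self ..)
    have hAN := hA N (List.mem_cons_self ..)
    have hdisj : Disjoint N.after (afterAll L) := by
      rw [Finset.disjoint_right]
      intro e he
      obtain ⟨N', hN', he'⟩ := mem_afterAll.1 he
      exact fun h => Finset.disjoint_left.1 (hpair.1 N' hN') he' (Finset.mem_union_right _ h)
    rw [afterAll, sum_powerset_union hdisj, sum_powerset_after hN, List.map_cons, List.prod_cons,
      Module.End.mul_apply]
    change ∑ X ∈ N.lines.powerset, _ = _
    refine Finset.sum_congr rfl fun X hX => ?_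
    have hX' := Finset.mem_powerset.1 hX
    set Y := X.image N.aft with hY
    have hYN : Y ⊆ N.after := Finset.image_subset_image hX'
    have hmem : ∀ l ∈ N.lines, (N.aft l ∈ Y ↔ l ∈ X) := by
      intro l hl
      rw [hY, Finset.mem_image]
      refine ⟨?_, fun h => ⟨l, h, rfl⟩⟩
      rintro ⟨l', hl', h⟩
      rwa [← hN.inj (hX' hl') hl h]
    have haft : ∀ l ∈ N.lines, N.aft l ∈ N.after := fun l hl => Finset.mem_image_of_mem _ hl
    have hbef : ∀ l ∈ N.lines, N.bef l ∈ N.before := fun l hl => Finset.mem_image_of_mem _ hl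
    -- The new front is read off in `A ∪ Y`: edges after `N` are not in `A`, and current edges of
    -- the other lines are not in `Y`.
    have hstate : (fun l => if l ∈ N.lines then decide (l ∈ X) else decide (f l ∈ A)) =
        fun l => decide ((if l ∈ N.lines then N.aft l else f l) ∈ A ∪ Y) := by
      funext l
      split_ifs with hl
      · rw [decide_eq_decide, Finset.mem_union, hmem l hl]
        have := Finset.disjoint_right.1 hAN (haft l hl)
        tauto
      · rw [decide_eq_decide, Finset.mem_union]
        have : f l ∉ Y := fun h => hf N (List.mem_cons_self ..) l (hYN h)
        tauto
    rw [hstate, ih hadv (fun N' hN' => hgood N' (List.mem_cons_of_mem _ hN')) hpair.2, Finset.mul_sum]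
    · refine Finset.sum_congr rfl fun Z hZ => ?_
      have hZ' := Finset.mem_powerset.1 hZ
      -- Later vertices decide no edge incident to `N`, so its weight does not depend on `Z`.
      have hw : N.wt (A ∪ (Y ∪ Z)) =
          N.ker (fun l => decide (f l ∈ A)) (fun l => decide (l ∈ X)) := by
        have hZdisj : ∀ e ∈ N.before ∪ N.after, e ∉ Z := by
          intro e he h
          obtain ⟨N', hN', he'⟩ := mem_afterAll.1 (hZ' h)
          exact Finset.disjoint_left.1 (hpair.1 N' hN') he' he
        refine hN.ker_congr _ _ _ _ (fun l hl => ?_) (fun l hl => ?_)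
        · rw [decide_eq_decide, hb l hl, Finset.mem_union, Finset.mem_union]
          have h1 := hZdisj _ (Finset.mem_union_left _ (hbef l hl))
          have h2 : N.bef l ∉ Y := fun h => Finset.disjoint_left.1 hN.disj (hbef l hl) (hYN h)
          tauto
        · rw [decide_eq_decide, Finset.mem_union, Finset.mem_union, hmem l hl]
          have h1 := hZdisj _ (Finset.mem_union_right _ (haft l hl))
          have h2 := Finset.disjoint_right.1 hAN (haft l hl)
          tauto
      rw [List.map_cons, List.prod_cons, hw, mul_assoc, Finset.union_assoc]
    · intro N' hN'
      rw [Finset.disjoint_union_left]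
      refine ⟨hA N' (List.mem_cons_of_mem _ hN'), ?_⟩
      rw [Finset.disjoint_left]
      exact fun e he h => Finset.disjoint_left.1 (hpair.1 N' hN') h
        (Finset.mem_union_right _ (hYN he))
    · intro N' hN' l
      split_ifs with hl
      · exact fun h => Finset.disjoint_left.1 (hpair.1 N' hN') h
          (Finset.mem_union_right _ (haft l hl))
      · exact hf N' (List.mem_cons_of_mem _ hN') l

end Node

section

variable {Λ E : Type*} [DecidableEq Λ]

/-- `Node.op` sums over sets of occupied lines, `R2` over bits; their identification makes the
crossing algebra available for state sums. -/
theorem op_eq_R2 {a b : Λ} (hab : a ≠ b) (bef aft : Λ → E) (w : Bool → Bool → Bool → Bool → ℂ) :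
    (Node.mk {a, b} bef aft fun s t => w (s a) (s b) (t a) (t b)).op = R2 a b w := by
  refine LinearMap.ext fun F => funext fun s => ?_
  have e : ∀ x y : Bool, (Function.update (Function.update s a x) b y) =
      fun l => if l ∈ ({a, b} : Finset Λ) then
        decide (l ∈ (if x then {a} else ∅) ∪ (if y then ({b} : Finset Λ) else ∅)) else s l := by
    intro x y
    funext l
    simp only [Function.update_apply, Finset.mem_insert, Finset.mem_singleton]
    by_cases h1 : l = b
    · subst h1
      cases x <;> cases y <;> simp [hab.symm]
    · by_cases h2 : l = a
      · subst h2
        cases x <;> cases y <;> simp [hab]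
      · simp [h1, h2]
  change ∑ X ∈ ({a, b} : Finset Λ).powerset, _ = _
  rw [R2_apply, Finset.sum_powerset_insert (by simpa using hab), ← insert_empty_eq b,
    Finset.sum_powerset_insert (by simp), Finset.sum_powerset_insert (by simp)]
  simp only [Finset.powerset_empty, Finset.sum_singleton, Fintype.sum_bool, e, if_true,
    Bool.false_eq_true, if_false]
  simp [hab, hab.symm]
  ring

theorem op_eq_R3 {a b c : Λ} (hab : a ≠ b) (hac : a ≠ c) (hbc : b ≠ c) (bef aft : Λ → E)
    (w : Bool → Bool → Bool → Bool → Bool → Bool → ℂ) :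
    (Node.mk {a, b, c} bef aft fun s t => w (s a) (s b) (s c) (t a) (t b) (t c)).op =
      R3 a b c w := by
  refine LinearMap.ext fun F => funext fun s => ?_
  have e : ∀ x y z : Bool,
      (Function.update (Function.update (Function.update s a x) b y) c z) =
      fun l => if l ∈ ({a, b, c} : Finset Λ) then
        decide (l ∈ (if x then {a} else ∅) ∪ (if y then ({b} : Finset Λ) else ∅) ∪
          (if z then ({c} : Finset Λ) else ∅)) else s l := by
    intro x y z
    funext l
    simp only [Function.update_apply, Finset.mem_insert, Finset.mem_singleton]
    by_cases h1 : l = c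
    · subst h1
      cases x <;> cases y <;> cases z <;> simp [hac.symm, hbc.symm]
    · by_cases h2 : l = b
      · subst h2
        cases x <;> cases y <;> cases z <;> simp [hab.symm, hbc]
      · by_cases h3 : l = a
        · subst h3
          cases x <;> cases y <;> cases z <;> simp [hab, hac]
        · simp [h1, h2, h3]
  change ∑ X ∈ ({a, b, c} : Finset Λ).powerset, _ = _
  rw [R3_apply, Finset.sum_powerset_insert (by simp [hab, hac]),
    Finset.sum_powerset_insert (by simpa using hbc),
    Finset.sum_powerset_insert (by simpa using hbc), ← insert_empty_eq c,
    Finset.sum_powerset_insert (by simp), Finset.sum_powerset_insert (by simp),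
    Finset.sum_powerset_insert (by simp), Finset.sum_powerset_insert (by simp)]
  simp only [Finset.powerset_empty, Finset.sum_singleton, Fintype.sum_bool, e, if_true,
    Bool.false_eq_true, if_false]
  simp [hab, hab.symm, hac, hac.symm, hbc, hbc.symm]
  ring

end

/-! ### Edges before and after a vertex -/

/-- The edge of the line `l` before its vertex `v`. -/
def befE (v : ℤ × ℤ) (l : Line) : Edge :=
  if l.1 = 0 then (v - hor, hor) else if l.1 = 1 then (v, ver) else (v - dia, dia)

/-- The edge of the line `l` after its vertex `v`. -/
def aftE (v : ℤ × ℤ) (l : Line) : Edge :=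
  if l.1 = 0 then (v, hor) else if l.1 = 1 then (v - ver, ver) else (v, dia)

@[simp] theorem befE_hL (v : ℤ × ℤ) (j : ℕ) : befE v (hL j) = (v - hor, hor) := rfl
@[simp] theorem befE_vL (v : ℤ × ℤ) (j : ℕ) : befE v (vL j) = (v, ver) := rfl
@[simp] theorem befE_dL (v : ℤ × ℤ) (j : ℕ) : befE v (dL j) = (v - dia, dia) := rfl
@[simp] theorem aftE_hL (v : ℤ × ℤ) (j : ℕ) : aftE v (hL j) = (v, hor) := rfl
@[simp] theorem aftE_vL (v : ℤ × ℤ) (j : ℕ) : aftE v (vL j) = (v - ver, ver) := rfl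
@[simp] theorem aftE_dL (v : ℤ × ℤ) (j : ℕ) : aftE v (dL j) = (v, dia) := rfl

theorem aftE_inj {v : ℤ × ℤ} {l l' : Line} (h : aftE v l = aftE v l') : l.1 = l'.1 := by
  obtain ⟨t, k⟩ := l
  obtain ⟨t', k'⟩ := l'
  revert h
  fin_cases t <;> fin_cases t' <;> simp [aftE, hor, ver, dia]

theorem aftE_eq_aftE {v v' : ℤ × ℤ} {l l' : Line} (h : aftE v l = aftE v' l') : v = v' := by
  obtain ⟨t, k⟩ := l
  obtain ⟨t', k'⟩ := l'
  revert h
  fin_cases t <;> fin_cases t' <;> simp [aftE, hor, ver, dia]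

/-- An edge shared in this way makes `v` the next vertex after `v'` on a line: to the right, above,
or to the lower right. -/
theorem aftE_eq_befE {v v' : ℤ × ℤ} {l l' : Line} (h : aftE v' l' = befE v l) :
    v = v' + hor ∨ v = v' - ver ∨ v = v' + dia := by
  obtain ⟨t, k⟩ := l
  obtain ⟨t', k'⟩ := l'
  revert h
  fin_cases t <;> fin_cases t' <;>
    simp [aftE, befE, hor, ver, dia, Prod.ext_iff] <;> omega

/-- The vertex `v'` does not precede the vertex `v` on a line. -/
def NotBefore (v v' : ℤ × ℤ) : Prop :=
  v ≠ v' ∧ v ≠ v' + hor ∧ v ≠ v' - ver ∧ v ≠ v' + dia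

/-- A node at the vertex `v`, with at most one line in each direction. -/
structure IsAt (N : Node Line Edge) (v : ℤ × ℤ) : Prop where
  bef : N.bef = befE v
  aft : N.aft = aftE v
  inj : Set.InjOn Prod.fst (N.lines : Set Line)
  ker_congr : ∀ s s' t t', (∀ l ∈ N.lines, s l = s' l) → (∀ l ∈ N.lines, t l = t' l) →
    N.ker s t = N.ker s' t'

theorem IsAt.disjoint {N N' : Node Line Edge} {v v' : ℤ × ℤ} (h : IsAt N v) (h' : IsAt N' v')
    (hv : NotBefore v v') : Disjoint N'.after (N.before ∪ N.after) := by
  rw [Finset.disjoint_left]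
  intro e he he'
  obtain ⟨l', -, rfl⟩ := Finset.mem_image.1 he
  rw [h'.aft] at he'
  rcases Finset.mem_union.1 he' with h1 | h1
  · obtain ⟨l, -, hl⟩ := Finset.mem_image.1 h1
    rw [h.bef] at hl
    rcases aftE_eq_befE hl.symm with h2 | h2 | h2
    exacts [hv.2.1 h2, hv.2.2.1 h2, hv.2.2.2 h2]
  · obtain ⟨l, -, hl⟩ := Finset.mem_image.1 h1
    rw [h.aft] at hl
    exact hv.1 (aftE_eq_aftE hl)

theorem IsAt.good {N : Node Line Edge} {v : ℤ × ℤ} (h : IsAt N v) : N.Good where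
  ker_congr := h.ker_congr
  inj := by
    intro l hl l' hl' e
    rw [h.aft] at e
    exact h.inj hl hl' (aftE_inj e)
  disj := by
    rw [Finset.disjoint_left]
    intro e he he'
    obtain ⟨l', -, rfl⟩ := Finset.mem_image.1 he
    obtain ⟨l, -, hl⟩ := Finset.mem_image.1 he'
    rw [h.aft, h.bef] at hl
    rcases aftE_eq_befE hl with h2 | h2 | h2 <;>
      · simp [Prod.ext_iff, hor, ver, dia] at h2

theorem Adv_range {node : ℕ → Node Line Edge} {fr : ℕ → Line → Edge} {K : ℕ}
    (h : ∀ c < K, (∀ l ∈ (node c).lines, fr c l = (node c).bef l) ∧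
      fr (c + 1) = fun l => if l ∈ (node c).lines then (node c).aft l else fr c l) :
    Node.Adv ((List.range K).map node) (fr 0) (fr K) := by
  induction K with
  | zero => exact (rfl : fr 0 = fr 0)
  | succ K ih =>
    rw [List.range_succ, List.map_append]
    refine (ih fun c hc => h c (by omega)).append ⟨(h K (by omega)).1, ?_⟩
    exact (h K (by omega)).2.symm

theorem mem_edges {D : Finset Step} {V : Finset (ℤ × ℤ)} {e : Edge} :
    e ∈ edges D V ↔ e.2 ∈ D ∧ (e.1 ∈ V ∨ e.1 + e.2 ∈ V) := by
  rw [edges, Finset.mem_union, Finset.mem_product, Finset.mem_image]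
  constructor
  · rintro (h | ⟨e', h, rfl⟩)
    · exact ⟨h.2, Or.inl h.1⟩
    · rw [Finset.mem_product] at h
      exact ⟨h.2, Or.inr (by simpa using h.1)⟩
  · rintro ⟨h1, h2 | h2⟩
    · exact Or.inl ⟨h2, h1⟩
    · exact Or.inr ⟨(e.1 + e.2, e.2), Finset.mem_product.2 ⟨h2, h1⟩, by simp⟩

/-- The edge `e` comes after a vertex of `V` on its line. -/
def IsAfter (V : Finset (ℤ × ℤ)) (e : Edge) : Prop :=
  if e.2 = ver then e.1 + ver ∈ V else e.1 ∈ V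

instance (V : Finset (ℤ × ℤ)) (e : Edge) : Decidable (IsAfter V e) := by
  unfold IsAfter; infer_instance

/-- The sum over the configurations with prescribed initial edges. -/
theorem sum_powerset_filter_isAfter {E A₀ : Finset Edge} {V : Finset (ℤ × ℤ)} (hA₀ : A₀ ⊆ E)
    (hV : ∀ e ∈ A₀, ¬ IsAfter V e) (f : Finset Edge → ℂ) :
    ∑ X ∈ (E.filter (IsAfter V)).powerset, f (A₀ ∪ X) =
      ∑ A ∈ E.powerset.filter (fun A => ∀ e ∈ E, ¬ IsAfter V e → (e ∈ A ↔ e ∈ A₀)), f A := by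
  refine Finset.sum_bij (fun X _ => A₀ ∪ X) ?_ ?_ ?_ (fun _ _ => rfl)
  · intro X hX
    rw [Finset.mem_powerset] at hX
    rw [Finset.mem_filter, Finset.mem_powerset]
    refine ⟨Finset.union_subset hA₀ (hX.trans (Finset.filter_subset _ _)), fun e _ he => ?_⟩
    rw [Finset.mem_union]
    have : e ∉ X := fun h => he (Finset.mem_filter.1 (hX h)).2
    tauto
  · intro X hX Y hY h
    rw [Finset.mem_powerset] at hX hY
    ext e
    have h' : e ∈ A₀ ∪ X ↔ e ∈ A₀ ∪ Y := by rw [h]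
    rw [Finset.mem_union, Finset.mem_union] at h'
    have h1 := hV e
    have h2 : e ∈ X → IsAfter V e := fun h => (Finset.mem_filter.1 (hX h)).2
    have h3 : e ∈ Y → IsAfter V e := fun h => (Finset.mem_filter.1 (hY h)).2
    tauto
  · intro A hA
    rw [Finset.mem_filter, Finset.mem_powerset] at hA
    refine ⟨A.filter (IsAfter V), ?_, ?_⟩
    · rw [Finset.mem_powerset]
      exact Finset.filter_subset_filter _ hA.1
    · ext e
      rw [Finset.mem_union, Finset.mem_filter]
      have h1 := hV e
      have h2 := @hA₀ e
      have h3 := hA.2 e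
      have h4 := @hA.1 e
      tauto

/-! ### The triangle -/

theorem mem_triangle {m : ℕ} {v : ℤ × ℤ} :
    v ∈ triangle m ↔ v.1 ≤ 0 ∧ -v.1 ≤ v.2 ∧ v.2 < m := by
  obtain ⟨x, y⟩ := v
  simp only [triangle, Finset.mem_image, Finset.mem_filter, Finset.mem_product, Finset.mem_range,
    Prod.exists, Prod.mk.injEq]
  constructor
  · rintro ⟨i, j, ⟨⟨h1, h2⟩, h3⟩, rfl, rfl⟩
    omega
  · rintro ⟨h1, h2, h3⟩
    exact ⟨(-x).toNat, y.toNat, by omega, by omega, by omega⟩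

section Triangle

variable (β : ℕ → ℂ)

/-- The vertex of the triangle in column `-i` on the diagonal line `c`. -/
noncomputable def triNode (i c : ℕ) : Node Line Edge :=
  ⟨{hL (i + c), dL c, vL i}, befE (-(i : ℤ), (i : ℤ) + c), aftE (-(i : ℤ), (i : ℤ) + c),
    fun s t => triKernel (wHV (β i)) (wDV (β i)) wHD (s (hL (i + c))) (s (dL c)) (s (vL i))
      (t (hL (i + c))) (t (dL c)) (t (vL i))⟩

theorem isAt_triNode (i c : ℕ) : IsAt (triNode β i c) (-(i : ℤ), (i : ℤ) + c) where
  bef := rfl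
  aft := rfl
  inj := by
    intro l hl l' hl' h
    simp only [triNode, Finset.coe_insert, Finset.coe_singleton, Set.mem_insert_iff,
      Set.mem_singleton_iff] at hl hl'
    rcases hl with rfl | rfl | rfl <;> rcases hl' with rfl | rfl | rfl <;> simp at h ⊢
  ker_congr := by
    intro s s' t t' hs ht
    simp only [triNode, Finset.mem_insert, Finset.mem_singleton, forall_eq_or_imp, forall_eq] at *
    rw [hs.1, hs.2.1, hs.2.2, ht.1, ht.2.1, ht.2.2]

theorem op_triNode (i c : ℕ) : (triNode β i c).op = opT β i c := by
  rw [opT_eq_R3]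
  exact op_eq_R3 (by simp) (by simp) (by simp) _ _ _

/-- The vertices of the last `r` columns of the triangle of size `m`. -/
noncomputable def triNodes (m : ℕ) : ℕ → List (Node Line Edge)
  | 0 => []
  | r + 1 => (List.range (m - r)).map (triNode β r) ++ triNodes m r

theorem mem_triNodes {m r : ℕ} {N : Node Line Edge} :
    N ∈ triNodes β m r ↔ ∃ i < r, ∃ c < m - i, N = triNode β i c := by
  induction r with
  | zero => simp [triNodes]
  | succ r ih =>
    rw [triNodes, List.mem_append, ih, List.mem_map]
    simp only [List.mem_range]
    constructor
    · rintro (⟨c, hc, rfl⟩ | ⟨i, hi, c, hc, rfl⟩)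
      · exact ⟨r, by omega, c, hc, rfl⟩
      · exact ⟨i, by omega, c, hc, rfl⟩
    · rintro ⟨i, hi, c, hc, rfl⟩
      rcases Nat.lt_succ_iff_lt_or_eq.1 hi with h | rfl
      · exact Or.inr ⟨i, h, c, hc, rfl⟩
      · exact Or.inl ⟨c, hc, rfl⟩

theorem prod_op_triNodes {m r : ℕ} :
    ((triNodes β m r).map Node.op).prod = colsOp β m m r := by
  induction r with
  | zero => rfl
  | succ r ih =>
    rw [triNodes, List.map_append, List.prod_append, ih, colsOp, colOp, List.map_map]
    congr 2
    refine List.map_congr_left fun c hc => ?_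
    have := List.mem_range.1 hc
    rw [if_pos (by omega)]
    exact op_triNode β r c

theorem pairwise_triNodes {m r : ℕ} : (triNodes β m r).Pairwise
    fun N N' => Disjoint N'.after (N.before ∪ N.after) := by
  induction r with
  | zero => exact List.Pairwise.nil
  | succ r ih =>
    rw [triNodes, List.pairwise_append]
    refine ⟨?_, ih, ?_⟩
    · rw [List.pairwise_map]
      refine List.pairwise_lt_range.imp fun {c c'} h => ?_
      refine (isAt_triNode β r c).disjoint (isAt_triNode β r c') ?_
      simp [NotBefore, hor, ver, dia, Prod.ext_iff]
      omega
    · intro N hN N' hN'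
      obtain ⟨c, -, rfl⟩ := List.mem_map.1 hN
      obtain ⟨i, hi, c', -, rfl⟩ := (mem_triNodes β).1 hN'
      refine (isAt_triNode β r c).disjoint (isAt_triNode β i c') ?_
      simp [NotBefore, hor, ver, dia, Prod.ext_iff]
      omega

/-- The current edge of a line of the triangle, when the columns to the left of column `-i`
and the first `c` vertices of the latter have been passed. -/
def triFront (m i c : ℕ) (l : Line) : Edge :=
  -- Lines of index at least `m` do not occur in the triangle; they are parked on an edge not
  -- incident to it, hence never occupied.
  if m ≤ l.2 then ((1, 0), hor)
  else if l.1 = 0 then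
    if l.2 < i then ((-(l.2 : ℤ) - 1, (l.2 : ℤ)), hor)
    else if l.2 < i + c then ((-(i : ℤ), (l.2 : ℤ)), hor)
    else ((-(i : ℤ) - 1, (l.2 : ℤ)), hor)
  else if l.1 = 1 then
    if l.2 < i then ((-(l.2 : ℤ), (l.2 : ℤ)), ver)
    else if l.2 = i then ((-(i : ℤ), (i : ℤ) + c), ver)
    else ((-(l.2 : ℤ), (m : ℤ)), ver)
  else
    if l.2 < c then ((-(i : ℤ), (i : ℤ) + l.2), dia)
    else if i + l.2 < m then ((-(i : ℤ) - 1, (i : ℤ) + l.2 + 1), dia)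
    else (((l.2 : ℤ) - m, (m : ℤ)), dia)

/-- The top of one column and the bottom of the next describe the same front, so the sweeps of the
columns can be concatenated. -/
theorem triFront_succ {m i : ℕ} (hi : i < m) :
    triFront m (i + 1) (m - (i + 1)) = triFront m i 0 := by
  funext ⟨t, k⟩
  fin_cases t
  all_goals
    simp [triFront]
    split_ifs <;> simp <;> omega

theorem adv_triNode {m i c : ℕ} (hc : c < m - i) :
    (∀ l ∈ (triNode β i c).lines, triFront m i c l = (triNode β i c).bef l) ∧
      triFront m i (c + 1) = fun l => if l ∈ (triNode β i c).lines then (triNode β i c).aft l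
        else triFront m i c l := by
  constructor
  · simp only [triNode, Finset.mem_insert, Finset.mem_singleton, forall_eq_or_imp, forall_eq,
      befE_hL, befE_vL, befE_dL]
    refine ⟨?_, ?_, ?_⟩
    · simp [triFront, hor]; omega
    · simp [triFront, dia]; split_ifs <;> simp <;> omega
    · simp [triFront]; omega
  · funext ⟨t, k⟩
    fin_cases t
    all_goals
      simp [triNode, triFront, aftE, ver]
      split_ifs <;> simp <;> omega

theorem adv_triNodes {m r : ℕ} (hr : r ≤ m) :
    Node.Adv (triNodes β m r) (triFront m r (m - r)) (triFront m 0 m) := by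
  induction r with
  | zero => exact (rfl : triFront m 0 m = triFront m 0 m)
  | succ r ih =>
    rw [triFront_succ (by omega)]
    exact (Adv_range (fr := triFront m r) fun c hc => adv_triNode β hc).append (ih (by omega))

/-- Along a line, each edge except the initial one follows a vertex; so the state sum runs over
exactly the edges that the initial state leaves undecided. -/
theorem afterAll_triNodes (m : ℕ) :
    Node.afterAll (triNodes β m m) = (edges triSteps (triangle m)).filter (IsAfter (triangle m)) := by
  ext ⟨⟨x, y⟩, s⟩
  rw [Node.mem_afterAll, Finset.mem_filter, mem_edges]
  simp only [mem_triNodes]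
  constructor
  · rintro ⟨_, ⟨i, hi, c, hc, rfl⟩, he⟩
    simp only [Node.after, triNode, Finset.image_insert, Finset.image_singleton, aftE_hL, aftE_dL,
      aftE_vL, Finset.mem_insert, Finset.mem_singleton, Prod.mk.injEq] at he
    rcases he with ⟨⟨rfl, rfl⟩, rfl⟩ | ⟨⟨rfl, rfl⟩, rfl⟩ | ⟨h, rfl⟩
    · simp [IsAfter, mem_triangle, triSteps, hor, ver, dia]; omega
    · simp [IsAfter, mem_triangle, triSteps, hor, ver, dia]; omega
    · simp [ver] at h
      obtain ⟨rfl, rfl⟩ := h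
      simp [IsAfter, mem_triangle, triSteps, hor, ver, dia]; omega
  · rintro ⟨⟨hs, -⟩, ha⟩
    simp only [triSteps, Finset.mem_insert, Finset.mem_singleton] at hs
    rcases hs with rfl | rfl | rfl
    · simp [IsAfter, mem_triangle, hor, ver] at ha
      refine ⟨_, ⟨(-x).toNat, by omega, (x + y).toNat, by omega, rfl⟩, ?_⟩
      simp [Node.after, triNode, Prod.ext_iff, hor, ver, dia]
      omega
    · simp [IsAfter, mem_triangle, dia, ver] at ha
      refine ⟨_, ⟨(-x).toNat, by omega, (x + y).toNat, by omega, rfl⟩, ?_⟩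
      simp [Node.after, triNode, Prod.ext_iff, hor, ver, dia]
      omega
    · simp [IsAfter, mem_triangle, ver] at ha
      refine ⟨_, ⟨(-x).toNat, by omega, (x + y - 1).toNat, by omega, rfl⟩, ?_⟩
      simp [Node.after, triNode, Prod.ext_iff, hor, ver, dia]
      omega

theorem not_isAfter_triFront {m : ℕ} (l : Line) :
    ¬ IsAfter (triangle m) (triFront m m 0 l) := by
  obtain ⟨t, k⟩ := l
  fin_cases t
  all_goals
    simp [triFront]
    split_ifs <;> simp [IsAfter, mem_triangle, hor, ver, dia] <;> omega

/-- The state sum of the triangle. -/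
theorem colsOp_apply_eq_sum {m : ℕ} {A₀ : Finset Edge} (hA₀ : A₀ ⊆ edges triSteps (triangle m))
    (hA : ∀ e ∈ A₀, ¬ IsAfter (triangle m) e) (F : LineFun Line) :
    colsOp β m m m F (fun l => decide (triFront m m 0 l ∈ A₀)) =
      ∑ A ∈ (edges triSteps (triangle m)).powerset.filter
        (fun A => ∀ e ∈ edges triSteps (triangle m), ¬ IsAfter (triangle m) e → (e ∈ A ↔ e ∈ A₀)),
        ((triNodes β m m).map fun N => N.wt A).prod *
          F (fun l => decide (triFront m 0 m l ∈ A)) := by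
  have h1 : ∀ N ∈ triNodes β m m, ∀ e ∈ N.after, IsAfter (triangle m) e := by
    intro N hN e he
    have : e ∈ Node.afterAll (triNodes β m m) := Node.mem_afterAll.2 ⟨N, hN, he⟩
    rw [afterAll_triNodes] at this
    exact (Finset.mem_filter.1 this).2
  have hadv := adv_triNodes β (le_refl m)
  rw [Nat.sub_self] at hadv
  rw [← sum_powerset_filter_isAfter hA₀ hA (fun A => ((triNodes β m m).map fun N => N.wt A).prod *
    F (fun l => decide (triFront m 0 m l ∈ A))), ← afterAll_triNodes β, ← prod_op_triNodes]
  refine Node.prod_op_apply F hadv ?_ (pairwise_triNodes β) ?_ ?_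
  · intro N hN
    obtain ⟨i, -, c, -, rfl⟩ := (mem_triNodes β).1 hN
    exact (isAt_triNode β i c).good
  · intro N hN
    rw [Finset.disjoint_left]
    exact fun e he he' => hA e he (h1 N hN e he')
  · intro N hN l hl
    exact not_isAfter_triFront l (h1 N hN _ hl)

end Triangle

/-! ### The square -/

theorem mem_square {n : ℕ} {v : ℤ × ℤ} :
    v ∈ square n ↔ v.1 ≤ 0 ∧ -v.1 < n ∧ 0 ≤ v.2 ∧ v.2 < n := by
  obtain ⟨x, y⟩ := v
  simp only [square, Finset.mem_image, Finset.mem_product, Finset.mem_range,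
    Prod.exists, Prod.mk.injEq]
  constructor
  · rintro ⟨i, j, ⟨h1, h2⟩, rfl, rfl⟩
    omega
  · rintro ⟨h1, h2, h3, h4⟩
    exact ⟨(-x).toNat, y.toNat, by omega, by omega, by omega⟩

section Square

variable (β : ℕ → ℂ) (N : ℕ)

/-- The vertex of the square in column `-i` and row `k`, on the horizontal line `N + k`. -/
noncomputable def sqNode (i k : ℕ) : Node Line Edge :=
  ⟨{hL (N + k), vL i}, befE (-(i : ℤ), (k : ℤ)), aftE (-(i : ℤ), (k : ℤ)),
    fun s t => wHV (β i) (s (hL (N + k))) (s (vL i)) (t (hL (N + k))) (t (vL i))⟩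

theorem isAt_sqNode (i k : ℕ) : IsAt (sqNode β N i k) (-(i : ℤ), (k : ℤ)) where
  bef := rfl
  aft := rfl
  inj := by
    intro l hl l' hl' h
    simp only [sqNode, Finset.coe_insert, Finset.coe_singleton, Set.mem_insert_iff,
      Set.mem_singleton_iff] at hl hl'
    rcases hl with rfl | rfl <;> rcases hl' with rfl | rfl <;> simp at h ⊢
  ker_congr := by
    intro s s' t t' hs ht
    simp only [sqNode, Finset.mem_insert, Finset.mem_singleton, forall_eq_or_imp, forall_eq] at *
    rw [hs.1, hs.2, ht.1, ht.2]

theorem op_sqNode (i k : ℕ) : (sqNode β N i k).op = opHV β i (N + k) :=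
  op_eq_R2 (by simp) _ _ _

/-- The vertices of the last `r` columns of the square of size `n`. -/
noncomputable def sqNodes (n : ℕ) : ℕ → List (Node Line Edge)
  | 0 => []
  | r + 1 => (List.range n).map (sqNode β N r) ++ sqNodes n r

theorem mem_sqNodes {n r : ℕ} {M : Node Line Edge} :
    M ∈ sqNodes β N n r ↔ ∃ i < r, ∃ k < n, M = sqNode β N i k := by
  induction r with
  | zero => simp [sqNodes]
  | succ r ih =>
    rw [sqNodes, List.mem_append, ih, List.mem_map]
    simp only [List.mem_range]
    constructor
    · rintro (⟨c, hc, rfl⟩ | ⟨i, hi, c, hc, rfl⟩)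
      · exact ⟨r, by omega, c, hc, rfl⟩
      · exact ⟨i, by omega, c, hc, rfl⟩
    · rintro ⟨i, hi, c, hc, rfl⟩
      rcases Nat.lt_succ_iff_lt_or_eq.1 hi with h | rfl
      · exact Or.inr ⟨i, h, c, hc, rfl⟩
      · exact Or.inl ⟨c, hc, rfl⟩

theorem prod_op_sqNodes {n r : ℕ} :
    ((sqNodes β N n r).map Node.op).prod = squareOp β N n r := by
  induction r with
  | zero => rfl
  | succ r ih =>
    rw [sqNodes, List.map_append, List.prod_append, ih, squareOp, opColumn, List.map_map]
    congr 2
    exact List.map_congr_left fun c _ => op_sqNode β N r c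

theorem pairwise_sqNodes {n r : ℕ} : (sqNodes β N n r).Pairwise
    fun M M' => Disjoint M'.after (M.before ∪ M.after) := by
  induction r with
  | zero => exact List.Pairwise.nil
  | succ r ih =>
    rw [sqNodes, List.pairwise_append]
    refine ⟨?_, ih, ?_⟩
    · rw [List.pairwise_map]
      refine List.pairwise_lt_range.imp fun {c c'} h => ?_
      refine (isAt_sqNode β N r c).disjoint (isAt_sqNode β N r c') ?_
      simp [NotBefore, hor, ver, dia, Prod.ext_iff]
      omega
    · intro M hM M' hM'
      obtain ⟨c, -, rfl⟩ := List.mem_map.1 hM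
      obtain ⟨i, hi, c', -, rfl⟩ := (mem_sqNodes β N).1 hM'
      refine (isAt_sqNode β N r c).disjoint (isAt_sqNode β N i c') ?_
      simp [NotBefore, hor, ver, dia, Prod.ext_iff]
      omega

/-- The current edge of a line of the square, when the columns to the left of column `-i`
and the first `c` vertices of the latter have been passed. -/
def sqFront (n i c : ℕ) (l : Line) : Edge :=
  if l.1 = 0 then
    -- Row `k` of the square is the line `N + k` of the triangle, so that both operators act on the
    -- same space. Lines missing the square are parked on an edge not incident to it.
    if l.2 < N ∨ N + n ≤ l.2 then ((1, 0), hor)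
    else if l.2 < N + c then ((-(i : ℤ), (l.2 : ℤ) - N), hor)
    else ((-(i : ℤ) - 1, (l.2 : ℤ) - N), hor)
  else if l.1 = 1 then
    if n ≤ l.2 then ((1, 0), hor)
    else if l.2 < i then ((-(l.2 : ℤ), 0), ver)
    else if l.2 = i then ((-(i : ℤ), (c : ℤ)), ver)
    else ((-(l.2 : ℤ), (n : ℤ)), ver)
  else ((1, 0), hor)

theorem sqFront_succ (n i : ℕ) : sqFront N n (i + 1) n = sqFront N n i 0 := by
  funext ⟨t, k⟩
  fin_cases t
  all_goals
    simp [sqFront]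
    try (split_ifs <;> simp <;> omega)

theorem adv_sqNode {n i c : ℕ} (hi : i < n) (hc : c < n) :
    (∀ l ∈ (sqNode β N i c).lines, sqFront N n i c l = (sqNode β N i c).bef l) ∧
      sqFront N n i (c + 1) = fun l => if l ∈ (sqNode β N i c).lines then (sqNode β N i c).aft l
        else sqFront N n i c l := by
  constructor
  · simp only [sqNode, Finset.mem_insert, Finset.mem_singleton, forall_eq_or_imp, forall_eq,
      befE_hL, befE_vL]
    refine ⟨?_, ?_⟩
    · simp [sqFront, hor]; omega
    · simp [sqFront]; omega
  · funext ⟨t, k⟩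
    fin_cases t
    all_goals
      simp [sqNode, sqFront, aftE, ver]
      try (split_ifs <;> simp <;> omega)

theorem adv_sqNodes {n r : ℕ} (hr : r ≤ n) :
    Node.Adv (sqNodes β N n r) (sqFront N n r n) (sqFront N n 0 n) := by
  induction r with
  | zero => exact (rfl : sqFront N n 0 n = sqFront N n 0 n)
  | succ r ih =>
    rw [sqFront_succ N n r]
    exact (Adv_range (fr := sqFront N n r) fun c hc => adv_sqNode β N (by omega) hc).append
      (ih (by omega))

theorem afterAll_sqNodes (n : ℕ) :
    Node.afterAll (sqNodes β N n n) = (edges sqSteps (square n)).filter (IsAfter (square n)) := by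
  ext ⟨⟨x, y⟩, s⟩
  rw [Node.mem_afterAll, Finset.mem_filter, mem_edges]
  simp only [mem_sqNodes]
  constructor
  · rintro ⟨_, ⟨i, hi, c, hc, rfl⟩, he⟩
    simp only [Node.after, sqNode, Finset.image_insert, Finset.image_singleton, aftE_hL,
      aftE_vL, Finset.mem_insert, Finset.mem_singleton, Prod.mk.injEq] at he
    rcases he with ⟨⟨rfl, rfl⟩, rfl⟩ | ⟨h, rfl⟩
    · simp [IsAfter, mem_square, sqSteps, hor, ver]; omega
    · simp [ver] at h
      obtain ⟨rfl, rfl⟩ := h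
      simp [IsAfter, mem_square, sqSteps, hor, ver]; omega
  · rintro ⟨⟨hs, -⟩, ha⟩
    simp only [sqSteps, Finset.mem_insert, Finset.mem_singleton] at hs
    rcases hs with rfl | rfl
    · simp [IsAfter, mem_square, hor, ver] at ha
      refine ⟨_, ⟨(-x).toNat, by omega, y.toNat, by omega, rfl⟩, ?_⟩
      simp [Node.after, sqNode, Prod.ext_iff, hor, ver]
      omega
    · simp [IsAfter, mem_square, ver] at ha
      refine ⟨_, ⟨(-x).toNat, by omega, (y - 1).toNat, by omega, rfl⟩, ?_⟩
      simp [Node.after, sqNode, Prod.ext_iff, hor, ver]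
      omega

theorem not_isAfter_sqFront {n : ℕ} (l : Line) :
    ¬ IsAfter (square n) (sqFront N n n n l) := by
  obtain ⟨t, k⟩ := l
  fin_cases t
  all_goals
    simp [sqFront]
    try split_ifs
    all_goals simp [IsAfter, mem_square, hor, ver] <;> omega

/-- The state sum of the square. -/
theorem squareOp_apply_eq_sum {n : ℕ} {A₀ : Finset Edge} (hA₀ : A₀ ⊆ edges sqSteps (square n))
    (hA : ∀ e ∈ A₀, ¬ IsAfter (square n) e) (F : LineFun Line) :
    squareOp β N n n F (fun l => decide (sqFront N n n n l ∈ A₀)) =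
      ∑ A ∈ (edges sqSteps (square n)).powerset.filter
        (fun A => ∀ e ∈ edges sqSteps (square n), ¬ IsAfter (square n) e → (e ∈ A ↔ e ∈ A₀)),
        ((sqNodes β N n n).map fun M => M.wt A).prod *
          F (fun l => decide (sqFront N n 0 n l ∈ A)) := by
  have h1 : ∀ M ∈ sqNodes β N n n, ∀ e ∈ M.after, IsAfter (square n) e := by
    intro M hM e he
    have : e ∈ Node.afterAll (sqNodes β N n n) := Node.mem_afterAll.2 ⟨M, hM, he⟩
    rw [afterAll_sqNodes] at this
    exact (Finset.mem_filter.1 this).2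
  rw [← sum_powerset_filter_isAfter hA₀ hA (fun A => ((sqNodes β N n n).map fun M => M.wt A).prod *
    F (fun l => decide (sqFront N n 0 n l ∈ A))), ← afterAll_sqNodes β N, ← prod_op_sqNodes]
  refine Node.prod_op_apply F (adv_sqNodes β N le_rfl) ?_ (pairwise_sqNodes β N) ?_ ?_
  · intro M hM
    obtain ⟨i, -, c, -, rfl⟩ := (mem_sqNodes β N).1 hM
    exact (isAt_sqNode β N i c).good
  · intro M hM
    rw [Finset.disjoint_left]
    exact fun e he he' => hA e he (h1 M hM e he')
  · intro M hM l hl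
    exact not_isAfter_sqFront N l (h1 M hM _ hl)

end Square

/-! ### The refinement -/

/-- If `u` holds up to $k-1$ and fails from $k$ on, only the term $x^{k-1}$ survives in the sum, and
exactly $k-1$ factors of the product equal $x$. -/
theorem sum_Icc_ite_pow {u : ℕ → Prop} [DecidablePred u] (h0 : u 0) (hu : ∀ k, u (k + 1) → u k)
    {m : ℕ} (hm : ¬ u m) (x : ℂ) :
    ∑ k ∈ Finset.Icc 1 m, (if u (k - 1) ∧ ¬ u k then x ^ (k - 1) else 0) =
      ∏ j ∈ Finset.range m, (if u (j + 1) then x else 1) := by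
  have hle : ∀ i k, i ≤ k → u k → u i := by
    intro i k hik
    induction k, hik using Nat.le_induction with
    | base => exact id
    | succ k _ ih => exact fun h => ih (hu k h)
  have hall : ∀ m, u m → (∑ k ∈ Finset.Icc 1 m, (if u (k - 1) ∧ ¬ u k then x ^ (k - 1) else 0)) = 0 ∧
      ∏ j ∈ Finset.range m, (if u (j + 1) then x else 1) = x ^ m := by
    intro m h
    constructor
    · refine Finset.sum_eq_zero fun k hk => if_neg ?_
      have := hle k m (Finset.mem_Icc.1 hk).2 h
      tauto
    · rw [Finset.prod_congr rfl fun j hj => if_pos (hle (j + 1) m (by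
        have := Finset.mem_range.1 hj; omega) h), Finset.prod_const, Finset.card_range]
  induction m with
  | zero => exact absurd h0 hm
  | succ m ih =>
    rw [Finset.sum_Icc_succ_top (by omega), Finset.prod_range_succ, if_neg hm, mul_one,
      Nat.add_sub_cancel]
    by_cases h : u m
    · rw [(hall m h).1, (hall m h).2, if_pos ⟨h, hm⟩, zero_add]
    · rw [ih h, if_neg (by tauto), add_zero]

/-- The topmost visited vertex of the last column, in terms of the vertical edges of this column. -/
theorem hitsLastColumnAt_iff {D : Finset Step} {m : ℕ} {A : Finset Edge}
    (hv : ∀ j < m, Visited D A (0, (j : ℤ)) ↔ ((0, (j : ℤ)), ver) ∈ A)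
    (hu : ∀ j : ℕ, ((0, ((j + 1 : ℕ) : ℤ)), ver) ∈ A → ((0, (j : ℤ)), ver) ∈ A)
    (hm : ((0, (m : ℤ)), ver) ∉ A) {k : ℕ} (hk : k ∈ Finset.Icc 1 m) :
    HitsLastColumnAt D m A k ↔
      ((0, ((k - 1 : ℕ) : ℤ)), ver) ∈ A ∧ ((0, (k : ℤ)), ver) ∉ A := by
  obtain ⟨h1, h2⟩ := Finset.mem_Icc.1 hk
  have hle : ∀ i j : ℕ, i ≤ j → ((0, (j : ℤ)), ver) ∈ A → ((0, (i : ℤ)), ver) ∈ A := by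
    intro i j hij
    induction j, hij using Nat.le_induction with
    | base => exact id
    | succ j _ ih => exact fun h => ih (hu j h)
  rw [HitsLastColumnAt, show ((k : ℤ) - 1) = ((k - 1 : ℕ) : ℤ) by omega, hv _ (by omega)]
  refine and_congr_right fun _ => ⟨fun h h' => ?_, fun h j hj h' => ?_⟩
  · rcases Nat.lt_or_ge k m with hkm | hkm
    · refine h (k + 1) (Finset.mem_Ioc.2 ⟨by omega, by omega⟩) ?_
      rw [show (((k + 1 : ℕ) : ℤ) - 1) = (k : ℤ) by omega, hv _ hkm]
      exact h'
    · obtain rfl : k = m := by omega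
      exact hm h'
  · obtain ⟨h3, h4⟩ := Finset.mem_Ioc.1 hj
    rw [show ((j : ℤ) - 1) = ((j - 1 : ℕ) : ℤ) by omega, hv _ (by omega)] at h'
    exact h (hle k (j - 1) (by omega) h')

/-! ### The ice rule -/

/-- The ice rule at the vertex `v`. -/
def IceAt (D : Finset Step) (A : Finset Edge) (v : ℤ × ℤ) : Prop :=
  inDeg D A v = D.card ∧ outDeg D A v = D.card

instance (D : Finset Step) (A : Finset Edge) (v : ℤ × ℤ) : Decidable (IceAt D A v) := by
  unfold IceAt; infer_instance

theorem mem_iceConfigs {D : Finset Step} {V : Finset (ℤ × ℤ)} {A : Finset Edge} :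
    A ∈ iceConfigs D V ↔ A ⊆ edges D V ∧ ∀ v ∈ V, IceAt D A v := by
  simp [iceConfigs, IceAt]

theorem iceAt_triSteps {A : Finset Edge} {v : ℤ × ℤ} : IceAt triSteps A v ↔
    triIce (decide ((v - hor, hor) ∈ A)) (decide ((v - dia, dia) ∈ A)) (decide ((v, ver) ∈ A))
      (decide ((v, hor) ∈ A)) (decide ((v, dia) ∈ A)) (decide ((v - ver, ver) ∈ A)) := by
  simp only [IceAt, inDeg, outDeg, triSteps, Finset.card_filter, triIce]
  rw [Finset.sum_insert (by decide), Finset.sum_insert (by decide), Finset.sum_singleton,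
    Finset.sum_insert (by decide), Finset.sum_insert (by decide), Finset.sum_singleton,
    Finset.sum_insert (by decide), Finset.sum_insert (by decide), Finset.sum_singleton,
    Finset.sum_insert (by decide), Finset.sum_insert (by decide), Finset.sum_singleton,
    show ({hor, dia, ver} : Finset Step).card = 3 by decide]
  by_cases p1 : (v - hor, hor) ∈ A <;> by_cases p2 : (v - dia, dia) ∈ A <;>
    by_cases p3 : (v - ver, ver) ∈ A <;> by_cases p4 : (v, hor) ∈ A <;>
    by_cases p5 : (v, dia) ∈ A <;> by_cases p6 : (v, ver) ∈ A <;>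
    simp [p1, p2, p3, p4, p5, p6]

/-- The ice rule for two lines. -/
def sqIce (h t h' t' : Bool) : Prop := h.toNat + t'.toNat = h'.toNat + t.toNat

instance (h t h' t' : Bool) : Decidable (sqIce h t h' t') := by
  unfold sqIce; infer_instance

theorem iceAt_sqSteps {A : Finset Edge} {v : ℤ × ℤ} : IceAt sqSteps A v ↔
    sqIce (decide ((v - hor, hor) ∈ A)) (decide ((v, ver) ∈ A))
      (decide ((v, hor) ∈ A)) (decide ((v - ver, ver) ∈ A)) := by
  simp only [IceAt, inDeg, outDeg, sqSteps, Finset.card_filter, sqIce]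
  rw [Finset.sum_insert (by decide), Finset.sum_singleton,
    Finset.sum_insert (by decide), Finset.sum_singleton,
    Finset.sum_insert (by decide), Finset.sum_singleton,
    Finset.sum_insert (by decide), Finset.sum_singleton,
    show ({hor, ver} : Finset Step).card = 2 by decide]
  by_cases p1 : (v - hor, hor) ∈ A <;> by_cases p3 : (v - ver, ver) ∈ A <;>
    by_cases p4 : (v, hor) ∈ A <;> by_cases p6 : (v, ver) ∈ A <;> simp [p1, p3, p4, p6]

/-- When the right and diagonal exits are empty, the number of paths entering the vertex equals the
occupation of the edge below it. -/
theorem iceAt_triSteps_of_empty {A : Finset Edge} {v : ℤ × ℤ} (h : IceAt triSteps A v)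
    (h1 : (v, hor) ∉ A) (h2 : (v, dia) ∉ A) :
    (Visited triSteps A v ↔ (v, ver) ∈ A) ∧ ((v - ver, ver) ∈ A → (v, ver) ∈ A) := by
  rw [iceAt_triSteps, triIce, decide_eq_false h1, decide_eq_false h2] at h
  simp only [Visited, triSteps, Finset.mem_insert, Finset.mem_singleton, exists_eq_or_imp,
    exists_eq_left, h1, h2]
  by_cases p1 : (v - hor, hor) ∈ A <;> by_cases p2 : (v - dia, dia) ∈ A <;>
    by_cases p3 : (v - ver, ver) ∈ A <;> by_cases p4 : (v, ver) ∈ A <;> simp_all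

theorem iceAt_sqSteps_of_empty {A : Finset Edge} {v : ℤ × ℤ} (h : IceAt sqSteps A v)
    (h1 : (v, hor) ∉ A) :
    (Visited sqSteps A v ↔ (v, ver) ∈ A) ∧ ((v - ver, ver) ∈ A → (v, ver) ∈ A) := by
  rw [iceAt_sqSteps, sqIce, decide_eq_false h1] at h
  simp only [Visited, sqSteps, Finset.mem_insert, Finset.mem_singleton, exists_eq_or_imp,
    exists_eq_left, h1]
  by_cases p1 : (v - hor, hor) ∈ A <;>
    by_cases p3 : (v - ver, ver) ∈ A <;> by_cases p4 : (v, ver) ∈ A <;> simp_all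

/-- The refined weight of the last column. -/
noncomputable def columnWeight (m : ℕ) (A : Finset Edge) (x : ℂ) : ℂ :=
  ∏ j ∈ Finset.range m, if ((0, ((j + 1 : ℕ) : ℤ)), ver) ∈ A then x else 1

/-- Vertical edges are occupied from the bottom up to the topmost visited vertex. The refinement
thus becomes a product of local factors, one for each vertex of the column, as needed for an
operator. -/
theorem sum_hitsLastColumnAt {D : Finset Step} {m : ℕ} {A : Finset Edge}
    (hv : ∀ j < m, (Visited D A (0, (j : ℤ)) ↔ ((0, (j : ℤ)), ver) ∈ A) ∧
      (((0, (j : ℤ)) - ver, ver) ∈ A → ((0, (j : ℤ)), ver) ∈ A))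
    (hA : ∀ j : ℕ, m ≤ j → ((0, (j : ℤ)), ver) ∉ A)
    (h0 : ((0, 0), ver) ∈ A) (x : ℂ) :
    ∑ k ∈ Finset.Icc 1 m, (if HitsLastColumnAt D m A k then x ^ (k - 1) else 0) =
      columnWeight m A x := by
  have hu : ∀ j : ℕ, ((0, ((j + 1 : ℕ) : ℤ)), ver) ∈ A → ((0, (j : ℤ)), ver) ∈ A := by
    intro j h
    rcases Nat.lt_or_ge j m with hj | hj
    · refine (hv j hj).2 ?_
      simpa [ver] using h
    · exact absurd h (hA _ (by omega))
  rw [columnWeight, ← sum_Icc_ite_pow (u := fun j : ℕ => ((0, (j : ℤ)), ver) ∈ A)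
    (by simpa using h0) hu (hA m le_rfl) x]
  refine Finset.sum_congr rfl fun k hk => ?_
  simp only [hitsLastColumnAt_iff (fun j hj => (hv j hj).1) hu (hA m le_rfl) hk]

/-! ### The partition function of the 20V model -/

theorem northVer_not_mem {m j : ℕ} (h : m < j) {A : Finset Edge}
    (hA : A ⊆ edges triSteps (triangle m)) : ((0, (j : ℤ)), ver) ∉ A := by
  intro h'
  have := mem_edges.1 (hA h')
  simp [mem_triangle, ver] at this
  omega

theorem Boundary3.zero_mem {m : ℕ} (hm : 1 ≤ m) {A : Finset Edge} (h : Boundary3 m A) :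
    ((0, 0), ver) ∈ A := by
  have := (h 0 (Finset.mem_range.2 hm)).2.2.2.2.2
  simp only [diagVer, Nat.cast_zero, neg_zero] at this
  exact this.2 (by omega)

theorem Z20V3_eq_sum {m : ℕ} (hm : 1 ≤ m) (x : ℂ) :
    Z20V3 m x = ∑ A ∈ (iceConfigs triSteps (triangle m)).filter (Boundary3 m),
      columnWeight m A x := by
  simp only [Z20V3, count3, Finset.card_filter, Nat.cast_sum, Finset.sum_mul]
  rw [Finset.sum_comm, Finset.sum_filter]
  refine Finset.sum_congr rfl fun A hA => ?_
  obtain ⟨hA1, hA2⟩ := mem_iceConfigs.1 hA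
  split_ifs with hB
  · rw [← sum_hitsLastColumnAt (D := triSteps) ?_ ?_ (hB.zero_mem hm)]
    · refine Finset.sum_congr rfl fun k _ => ?_
      by_cases h : HitsLastColumnAt triSteps m A k <;> simp [h, hB]
    · intro j hj
      have := hB j (Finset.mem_range.2 hj)
      refine iceAt_triSteps_of_empty (hA2 _ ?_) this.2.2.1 this.2.2.2.1
      rw [mem_triangle]
      simp only
      omega
    · intro j hj
      rcases Nat.eq_or_lt_of_le hj with rfl | h
      · simpa [northVer] using (hB 0 (Finset.mem_range.2 hm)).1
      · exact northVer_not_mem h hA1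
  · exact Finset.sum_eq_zero fun k _ => by simp [hB]

/-- The weights on the columns. -/
noncomputable def colParam (b : ℂ) (i : ℕ) : ℂ := if i = 0 then b else rt2

theorem colParam_ne_zero {b : ℂ} (hb : b ≠ 0) (i : ℕ) : colParam b i ≠ 0 := by
  unfold colParam
  split_ifs
  exacts [hb, rt2_ne_zero]

theorem prod_map_triNodes (β : ℕ → ℂ) (m r : ℕ) (f : Node Line Edge → ℂ) :
    ((triNodes β m r).map f).prod =
      ∏ i ∈ Finset.range r, ∏ c ∈ Finset.range (m - i), f (triNode β i c) := by
  induction r with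
  | zero => simp [triNodes]
  | succ r ih =>
    rw [triNodes, List.map_append, List.prod_append, ih, Finset.prod_range_succ, mul_comm,
      List.map_map]
    rfl

theorem prod_map_sqNodes (β : ℕ → ℂ) (N n r : ℕ) (f : Node Line Edge → ℂ) :
    ((sqNodes β N n r).map f).prod =
      ∏ i ∈ Finset.range r, ∏ c ∈ Finset.range n, f (sqNode β N i c) := by
  induction r with
  | zero => simp [sqNodes]
  | succ r ih =>
    rw [sqNodes, List.map_append, List.prod_append, ih, Finset.prod_range_succ, mul_comm,
      List.map_map]
    rfl

theorem wt_triNode (β : ℕ → ℂ) {i c : ℕ} {v : ℤ × ℤ} (hv : v = (-(i : ℤ), (i : ℤ) + c))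
    (A : Finset Edge) : (triNode β i c).wt A = triKernel (wHV (β i)) (wDV (β i)) wHD
      (decide ((v - hor, hor) ∈ A)) (decide ((v - dia, dia) ∈ A)) (decide ((v, ver) ∈ A))
      (decide ((v, hor) ∈ A)) (decide ((v, dia) ∈ A)) (decide ((v - ver, ver) ∈ A)) := by
  subst hv
  rfl

/-- This is where the spectral parameter of the last column turns into the refinement variable
$\sqrt2\,b-1$. -/
theorem wt_triNode_zero {b : ℂ} (hb : b ≠ 0) (c : ℕ) {A : Finset Edge}
    (h1 : ((0, (c : ℤ)), hor) ∉ A) (h2 : ((0, (c : ℤ)), dia) ∉ A) :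
    (triNode (colParam b) 0 c).wt A = if IceAt triSteps A (0, (c : ℤ)) then
      (if ((0, ((c + 1 : ℕ) : ℤ)), ver) ∈ A then rt2 * b - 1 else 1) else 0 := by
  have e' : ((0, (c : ℤ)) - ver : ℤ × ℤ) = (0, ((c + 1 : ℕ) : ℤ)) := by simp [ver]
  rw [if_congr iceAt_triSteps rfl rfl,
    wt_triNode (v := (0, (c : ℤ))) _ (by simp), decide_eq_false h1, decide_eq_false h2, colParam,
    if_pos rfl, triKernel_of_empty hb, e']
  simp only [decide_eq_true_eq]

theorem wt_triNode_of_ne_zero {b : ℂ} {i c : ℕ} (hi : i ≠ 0) (A : Finset Edge) :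
    (triNode (colParam b) i c).wt A =
      if IceAt triSteps A (-(i : ℤ), (i : ℤ) + c) then 1 else 0 := by
  rw [if_congr iceAt_triSteps rfl rfl, wt_triNode _ rfl, colParam, if_neg hi, triKernel_rt2]

theorem prod_wt_triNodes {b : ℂ} (hb : b ≠ 0) {m : ℕ} (hm : 1 ≤ m) {A : Finset Edge}
    (h1 : ∀ k < m, ((0, (k : ℤ)), hor) ∉ A) (h2 : ∀ k < m, ((0, (k : ℤ)), dia) ∉ A) :
    ((triNodes (colParam b) m m).map fun N => N.wt A).prod =
      if ∀ v ∈ triangle m, IceAt triSteps A v then columnWeight m A (rt2 * b - 1) else 0 := by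
  obtain ⟨m, rfl⟩ : ∃ k, m = k + 1 := ⟨m - 1, by omega⟩
  rw [prod_map_triNodes, Finset.prod_range_succ', Nat.sub_zero,
    Finset.prod_congr rfl fun c hc => wt_triNode_zero hb c (h1 c (Finset.mem_range.1 hc))
      (h2 c (Finset.mem_range.1 hc)),
    Finset.prod_congr rfl fun i _ => Finset.prod_congr rfl fun c _ =>
      wt_triNode_of_ne_zero (Nat.succ_ne_zero i) A,
    Finset.prod_ite_zero, columnWeight]
  simp only [Finset.prod_ite_zero, Finset.prod_const_one]
  by_cases h : ∀ v ∈ triangle (m + 1), IceAt triSteps A v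
  · rw [if_pos h, if_pos, if_pos, one_mul]
    · intro c hc
      have := Finset.mem_range.1 hc
      refine h _ ?_
      rw [mem_triangle]
      simp only
      omega
    · intro i hi c hc
      have := Finset.mem_range.1 hc
      have := Finset.mem_range.1 hi
      refine h _ ?_
      rw [mem_triangle]
      simp only
      omega
  · rw [if_neg h]
    push Not at h
    obtain ⟨⟨x, y⟩, hv, hice⟩ := h
    rw [mem_triangle] at hv
    simp only at hv
    by_cases hx : x = 0
    · subst hx
      rw [mul_comm, if_neg, zero_mul]
      intro h'
      have := h' y.toNat (Finset.mem_range.2 (by omega))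
      rw [Int.toNat_of_nonneg (by omega)] at this
      exact hice this
    · rw [if_neg, zero_mul]
      intro h'
      -- The index is shifted by one because the last column was split off from the product.
      have := h' ((-x).toNat - 1) (Finset.mem_range.2 (by omega)) (x + y).toNat
        (Finset.mem_range.2 (by omega))
      refine hice ?_
      convert this using 2
      · push_cast; omega
      · push_cast; omega

/-- The occupation of the initial edges of the triangle in the model 20V₃. -/
def initOcc (m : ℕ) (e : Edge) : Prop :=
  (e.2 = hor ∧ (m : ℤ) ≤ 2 * e.1.2 + 1) ∨ (e.2 = ver ∧ 2 * e.1.2 + 1 ≤ m)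

instance (m : ℕ) (e : Edge) : Decidable (initOcc m e) := by
  unfold initOcc; infer_instance

/-- The occupied initial edges of the triangle in the model 20V₃. -/
def initEdges (m : ℕ) : Finset Edge :=
  (edges triSteps (triangle m)).filter fun e => ¬ IsAfter (triangle m) e ∧ initOcc m e

/-- The edges leaving the triangle through the North and East boundaries are empty. -/
def FinalEmpty (m : ℕ) (A : Finset Edge) : Prop :=
  ∀ k ∈ Finset.range m, ((0, (k : ℤ)), hor) ∉ A ∧ ((-(k : ℤ), (m : ℤ)), ver) ∉ A ∧
    ((0, (k : ℤ)), dia) ∉ A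

instance (m : ℕ) (A : Finset Edge) : Decidable (FinalEmpty m A) := by
  unfold FinalEmpty; infer_instance

/-- Of the external edges, those of the diagonal boundary and the diagonal ones in the North are
initial and give the starting state. The remaining ones are final and empty, which is the vacuum. -/
theorem boundary3_iff {m : ℕ} {A : Finset Edge} : Boundary3 m A ↔
    (∀ e ∈ edges triSteps (triangle m), ¬ IsAfter (triangle m) e → (e ∈ A ↔ e ∈ initEdges m)) ∧
    FinalEmpty m A := by
  have hI : ∀ e ∈ edges triSteps (triangle m), ¬ IsAfter (triangle m) e →
      (e ∈ initEdges m ↔ initOcc m e) := by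
    intro e h1 h2
    rw [initEdges, Finset.mem_filter]
    exact ⟨fun h => h.2.2, fun h => ⟨h1, h2, h⟩⟩
  constructor
  · intro h
    refine ⟨?_, fun k hk => ?_⟩
    · rintro ⟨⟨x, y⟩, s⟩ h1 h2
      rw [hI _ h1 h2]
      rw [mem_edges] at h1
      obtain ⟨hs, h1⟩ := h1
      simp only [triSteps, Finset.mem_insert, Finset.mem_singleton] at hs
      rcases hs with rfl | rfl | rfl
      · simp [IsAfter, mem_triangle, hor, ver] at h1 h2
        have := (h y.toNat (Finset.mem_range.2 (by omega))).2.2.2.2.1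
        rw [diagHor, Int.toNat_of_nonneg (by omega)] at this
        obtain rfl : x = -y - 1 := by omega
        rw [this]
        simp [initOcc, hor, ver]
        omega
      · simp [IsAfter, mem_triangle, dia, ver] at h1 h2
        have := (h (-x - 1).toNat (Finset.mem_range.2 (by omega))).2.1
        rw [northDia, Int.toNat_of_nonneg (by omega)] at this
        obtain rfl : y = m := by omega
        rw [show -(-x - 1) - 1 = x by ring] at this
        simp [initOcc, hor, ver, this]
      · simp [IsAfter, mem_triangle, ver] at h1 h2
        have := (h y.toNat (Finset.mem_range.2 (by omega))).2.2.2.2.2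
        rw [diagVer, Int.toNat_of_nonneg (by omega)] at this
        obtain rfl : x = -y := by omega
        rw [this]
        simp [initOcc, hor, ver]
        omega
    · have := h k hk
      exact ⟨this.2.2.1, this.1, this.2.2.2.1⟩
  · rintro ⟨h1, h2⟩ i hi
    have him := Finset.mem_range.1 hi
    refine ⟨(h2 i hi).2.1, ?_, (h2 i hi).1, (h2 i hi).2.2, ?_, ?_⟩
    · have e1 : northDia m i ∈ edges triSteps (triangle m) := by
        rw [mem_edges]
        simp [northDia, triSteps, mem_triangle, dia]
        omega
      have e2 : ¬ IsAfter (triangle m) (northDia m i) := by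
        simp [northDia, IsAfter, mem_triangle, dia, ver]
      rw [h1 _ e1 e2, hI _ e1 e2]
      simp [northDia, initOcc, hor, ver]
    · have e1 : diagHor i ∈ edges triSteps (triangle m) := by
        rw [mem_edges]
        simp [diagHor, triSteps, mem_triangle, hor]
        omega
      have e2 : ¬ IsAfter (triangle m) (diagHor i) := by
        simp [diagHor, IsAfter, mem_triangle, hor, ver]
      rw [h1 _ e1 e2, hI _ e1 e2]
      simp [diagHor, initOcc, hor, ver]
      omega
    · have e1 : diagVer i ∈ edges triSteps (triangle m) := by
        rw [mem_edges]
        simp [diagVer, triSteps, mem_triangle, ver]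
        omega
      have e2 : ¬ IsAfter (triangle m) (diagVer i) := by
        simp [diagVer, IsAfter, mem_triangle, ver]
      rw [h1 _ e1 e2, hI _ e1 e2]
      simp [diagVer, initOcc, hor, ver]
      omega

theorem vacuum_triFront {m : ℕ} {A : Finset Edge} :
    vacuum m (fun l => decide (triFront m 0 m l ∈ A)) =
      if FinalEmpty m A then 1 else 0 := by
  unfold vacuum
  refine if_congr ⟨fun h k hk => ?_, fun h t k hk => ?_⟩ rfl rfl
  · rw [Finset.mem_range] at hk
    have h0 := h 0 k hk
    have h1 := h 1 k hk
    have h2 := h 2 k hk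
    simp [triFront, hk, not_le.2 hk] at h0 h1 h2
    refine ⟨h0, ?_, h2⟩
    split_ifs at h1 with hk0
    · subst hk0
      simpa using h1
    · exact h1
  · have := h k (Finset.mem_range.2 hk)
    fin_cases t
    · simpa [triFront, hk, not_le.2 hk] using this.1
    · simp [triFront, not_le.2 hk]
      split_ifs with hk0
      · subst hk0
        simpa using this.2.1
      · exact this.2.1
    · simpa [triFront, hk, not_le.2 hk] using this.2.2

/-- The initial occupation numbers of the lines. -/
def initState (m : ℕ) (l : Line) : Bool := decide (triFront m m 0 l ∈ initEdges m)

/-- The crossing weights involve $b^{-1}$, so this description misses the value $\tau=-1$. -/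
theorem Z20V3_eq_colsOp {m : ℕ} (hm : 1 ≤ m) {b : ℂ} (hb : b ≠ 0) :
    Z20V3 m (rt2 * b - 1) = colsOp (colParam b) m m m (vacuum m) (initState m) := by
  have := colsOp_apply_eq_sum (colParam b) (m := m) (A₀ := initEdges m) (Finset.filter_subset _ _)
    (fun e he => (Finset.mem_filter.1 he).2.1) (vacuum m)
  unfold initState
  rw [this, Z20V3_eq_sum hm, iceConfigs, Finset.filter_filter, Finset.sum_filter, Finset.sum_filter]
  refine Finset.sum_congr rfl fun A _ => ?_
  rw [vacuum_triFront]
  by_cases h1 : ∀ e ∈ edges triSteps (triangle m), ¬ IsAfter (triangle m) e →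
    (e ∈ A ↔ e ∈ initEdges m)
  · rw [if_pos h1]
    by_cases h2 : FinalEmpty m A
    · have h3 := boundary3_iff.2 ⟨h1, h2⟩
      rw [if_pos h2, mul_one, prod_wt_triNodes hb hm (fun k hk => (h2 k (Finset.mem_range.2 hk)).1)
        fun k hk => (h2 k (Finset.mem_range.2 hk)).2.2]
      by_cases h4 : ∀ v ∈ triangle m, IceAt triSteps A v
      · rw [if_pos h4, if_pos ⟨h4, h3⟩]
      · rw [if_neg h4, if_neg fun h => h4 h.1]
    · rw [if_neg h2, mul_zero, if_neg fun h => h2 (boundary3_iff.1 h.2).2]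
  · rw [if_neg h1, if_neg fun h => h1 (boundary3_iff.1 h.2).1]

theorem initState_hL {m j : ℕ} (hj : j < m) : initState m (hL j) = decide (m ≤ 2 * j + 1) := by
  rw [initState, decide_eq_decide, initEdges, Finset.mem_filter, mem_edges]
  simp [triFront, hj, not_le.2 hj, IsAfter, initOcc, mem_triangle, triSteps, hor, ver]
  omega

theorem initState_vL {m i : ℕ} (hi : i < m) : initState m (vL i) = decide (2 * i + 1 ≤ m) := by
  rw [initState, decide_eq_decide, initEdges, Finset.mem_filter, mem_edges]
  simp [triFront, hi, not_le.2 hi, IsAfter, initOcc, mem_triangle, triSteps, hor, ver]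
  omega

theorem initState_dL (m c : ℕ) : initState m (dL c) = false := by
  rw [initState, decide_eq_false_iff_not, initEdges, Finset.mem_filter, mem_edges]
  by_cases h : m ≤ c <;> simp [triFront, h, IsAfter, initOcc, mem_triangle, triSteps, hor, ver]

theorem initState_of_le {m : ℕ} {l : Line} (hl : m ≤ l.2) : initState m l = false := by
  rw [initState, decide_eq_false_iff_not, initEdges, Finset.mem_filter, mem_edges]
  simp [triFront, hl, IsAfter, mem_triangle, triSteps, hor, ver]


/-! ### The partition function of the 6V model -/

/-- The weight of a configuration of the 6V model. -/
noncomputable def sqWeight (n : ℕ) (A : Finset Edge) : ℂ :=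
  ∏ v ∈ square n, weight6V (1 : ℂ) rt2 1 A v

theorem northVer_not_mem_square {n j : ℕ} (h : n < j) {A : Finset Edge}
    (hA : A ⊆ edges sqSteps (square n)) : ((0, (j : ℤ)), ver) ∉ A := by
  intro h'
  have := mem_edges.1 (hA h')
  simp [mem_square, ver] at this
  omega

theorem Z6V_eq_sum {n : ℕ} (hn : 1 ≤ n) (x : ℂ) :
    Z6V n x = ∑ A ∈ (iceConfigs sqSteps (square n)).filter (BoundaryDW n),
      sqWeight n A * columnWeight n A x := by
  simp only [Z6V, part6V, Finset.sum_filter, Finset.sum_mul]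
  rw [Finset.sum_comm]
  refine Finset.sum_congr rfl fun A hA => ?_
  obtain ⟨hA1, hA2⟩ := mem_iceConfigs.1 hA
  split_ifs with hB
  · rw [← sum_hitsLastColumnAt (D := sqSteps) ?_ ?_ ?_, Finset.mul_sum]
    · refine Finset.sum_congr rfl fun k _ => ?_
      by_cases h : HitsLastColumnAt sqSteps n A k <;> simp [h, hB, sqWeight]
    · intro j hj
      have := hB j (Finset.mem_range.2 hj)
      refine iceAt_sqSteps_of_empty (hA2 _ ?_) this.2.1
      rw [mem_square]
      simp only
      omega
    · intro j hj
      rcases Nat.eq_or_lt_of_le hj with rfl | h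
      · simpa using (hB 0 (Finset.mem_range.2 hn)).2.2.1
      · exact northVer_not_mem_square h hA1
    · simpa using (hB 0 (Finset.mem_range.2 hn)).2.2.2
  · exact Finset.sum_eq_zero fun k _ => by simp [hB]

theorem wt_sqNode (β : ℕ → ℂ) (N : ℕ) {i c : ℕ} {v : ℤ × ℤ} (hv : v = (-(i : ℤ), (c : ℤ)))
    (A : Finset Edge) : (sqNode β N i c).wt A = wHV (β i)
      (decide ((v - hor, hor) ∈ A)) (decide ((v, ver) ∈ A))
      (decide ((v, hor) ∈ A)) (decide ((v - ver, ver) ∈ A)) := by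
  subst hv
  rfl

/-- Since the right edge is empty, an occupied edge above the vertex means a path going straight
down. It has weight $b=\sqrt2\,x$ instead of $\sqrt2$, and the other weights do not change. -/
theorem wt_sqNode_zero (x : ℂ) (N c : ℕ) {A : Finset Edge} (h1 : ((0, (c : ℤ)), hor) ∉ A) :
    (sqNode (colParam (rt2 * x)) N 0 c).wt A = if IceAt sqSteps A (0, (c : ℤ)) then
      weight6V (1 : ℂ) rt2 1 A (0, (c : ℤ)) *
        (if ((0, ((c + 1 : ℕ) : ℤ)), ver) ∈ A then x else 1) else 0 := by
  have e' : ((0, ((c + 1 : ℕ) : ℤ)) : ℤ × ℤ) = (0, (c : ℤ)) - ver := by simp [ver]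
  rw [if_congr iceAt_sqSteps rfl rfl,
    wt_sqNode (v := (0, (c : ℤ))) _ _ (by simp), decide_eq_false h1, colParam, if_pos rfl, e',
    weight6V]
  generalize ((0, (c : ℤ)) : ℤ × ℤ) = v at *
  by_cases p1 : (v - hor, hor) ∈ A <;> by_cases p3 : (v - ver, ver) ∈ A <;>
    by_cases p6 : (v, ver) ∈ A <;> simp [p1, p3, p6, h1, sqIce, wHV]

/-- At $b=\sqrt2$ the second turning weight $1-\sqrt2\,b+b^2$ also equals $1$. -/
theorem wt_sqNode_of_ne_zero (b : ℂ) (N : ℕ) {i c : ℕ} (hi : i ≠ 0) (A : Finset Edge) :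
    (sqNode (colParam b) N i c).wt A =
      if IceAt sqSteps A (-(i : ℤ), (c : ℤ)) then weight6V (1 : ℂ) rt2 1 A (-(i : ℤ), (c : ℤ))
        else 0 := by
  rw [if_congr iceAt_sqSteps rfl rfl, wt_sqNode _ _ rfl, colParam, if_neg hi, weight6V]
  generalize ((-(i : ℤ), (c : ℤ)) : ℤ × ℤ) = v
  have h := rt2_mul_self
  have h' : rt2 ^ 2 = 2 := by rw [sq, h]
  by_cases p1 : (v - hor, hor) ∈ A <;> by_cases p3 : (v - ver, ver) ∈ A <;>
    by_cases p4 : (v, hor) ∈ A <;>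
    by_cases p6 : (v, ver) ∈ A <;> simp only [p1, p3, p4, p6, sqIce, wHV] <;> simp [h, h']

theorem sqWeight_eq_prod (n : ℕ) (A : Finset Edge) : sqWeight n A =
    ∏ i ∈ Finset.range n, ∏ c ∈ Finset.range n,
      weight6V (1 : ℂ) rt2 1 A (-(i : ℤ), (c : ℤ)) := by
  rw [sqWeight, square, Finset.prod_image, Finset.prod_product]
  rintro ⟨i, j⟩ _ ⟨i', j'⟩ _ h
  simp only [Prod.mk.injEq] at h ⊢
  omega

theorem prod_wt_sqNodes (x : ℂ) (N : ℕ) {n : ℕ} (hn : 1 ≤ n) {A : Finset Edge}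
    (h1 : ∀ k < n, ((0, (k : ℤ)), hor) ∉ A) :
    ((sqNodes (colParam (rt2 * x)) N n n).map fun M => M.wt A).prod =
      if ∀ v ∈ square n, IceAt sqSteps A v then sqWeight n A * columnWeight n A x else 0 := by
  obtain ⟨r, hr⟩ : ∃ r, n = r + 1 := ⟨n - 1, by omega⟩
  rw [prod_map_sqNodes, hr, Finset.prod_range_succ', ← hr,
    Finset.prod_congr rfl fun c hc => wt_sqNode_zero x N c (h1 c (Finset.mem_range.1 hc)),
    Finset.prod_congr rfl fun i _ => Finset.prod_congr rfl fun c _ =>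
      wt_sqNode_of_ne_zero (rt2 * x) N (Nat.succ_ne_zero i) A,
    Finset.prod_ite_zero]
  simp only [Finset.prod_ite_zero]
  by_cases h : ∀ v ∈ square n, IceAt sqSteps A v
  · rw [if_pos h, if_pos, if_pos, Finset.prod_mul_distrib, ← mul_assoc, sqWeight_eq_prod]
    · congr 1
      conv_rhs => rw [hr, Finset.prod_range_succ', ← hr]
      simp
    · intro c hc
      have := Finset.mem_range.1 hc
      refine h _ ?_
      rw [mem_square]
      simp only
      omega
    · intro i hi c hc
      have := Finset.mem_range.1 hc
      have := Finset.mem_range.1 hi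
      refine h _ ?_
      rw [mem_square]
      simp only
      omega
  · rw [if_neg h]
    push Not at h
    obtain ⟨⟨u, y⟩, hv, hice⟩ := h
    rw [mem_square] at hv
    simp only at hv
    by_cases hu : u = 0
    · subst hu
      rw [mul_comm, if_neg, zero_mul]
      intro h'
      have := h' y.toNat (Finset.mem_range.2 (by omega))
      rw [Int.toNat_of_nonneg (by omega)] at this
      exact hice this
    · rw [if_neg, zero_mul]
      intro h'
      have := h' ((-u).toNat - 1) (Finset.mem_range.2 (by omega)) y.toNat
        (Finset.mem_range.2 (by omega))
      refine hice ?_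
      convert this using 2
      · push_cast; omega
      · omega

/-- The initial edges of the square, which are all occupied. -/
def sqInitEdges (n : ℕ) : Finset Edge :=
  (edges sqSteps (square n)).filter fun e => ¬ IsAfter (square n) e

/-- The edges leaving the square through the North and East boundaries are empty. -/
def SqFinalEmpty (n : ℕ) (A : Finset Edge) : Prop :=
  ∀ k ∈ Finset.range n, ((0, (k : ℤ)), hor) ∉ A ∧ ((-(k : ℤ), (n : ℤ)), ver) ∉ A

instance (n : ℕ) (A : Finset Edge) : Decidable (SqFinalEmpty n A) := by
  unfold SqFinalEmpty; infer_instance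

theorem boundaryDW_iff {n : ℕ} {A : Finset Edge} : BoundaryDW n A ↔
    (∀ e ∈ edges sqSteps (square n), ¬ IsAfter (square n) e → (e ∈ A ↔ e ∈ sqInitEdges n)) ∧
    SqFinalEmpty n A := by
  have hI : ∀ e ∈ edges sqSteps (square n), ¬ IsAfter (square n) e →
      (e ∈ sqInitEdges n ↔ True) := by
    intro e h1 h2
    rw [sqInitEdges, Finset.mem_filter]
    exact ⟨fun _ => trivial, fun _ => ⟨h1, h2⟩⟩
  constructor
  · intro h
    refine ⟨?_, fun k hk => ?_⟩
    · rintro ⟨⟨x, y⟩, s⟩ h1 h2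
      rw [hI _ h1 h2, iff_true]
      rw [mem_edges] at h1
      obtain ⟨hs, h1⟩ := h1
      simp only [sqSteps, Finset.mem_insert, Finset.mem_singleton] at hs
      rcases hs with rfl | rfl
      · simp [IsAfter, mem_square, hor, ver] at h1 h2
        have := (h y.toNat (Finset.mem_range.2 (by omega))).1
        rw [Int.toNat_of_nonneg (by omega)] at this
        obtain rfl : x = -n := by omega
        exact this
      · simp [IsAfter, mem_square, ver] at h1 h2
        have := (h (-x).toNat (Finset.mem_range.2 (by omega))).2.2.2
        rw [Int.toNat_of_nonneg (by omega), neg_neg] at this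
        obtain rfl : y = 0 := by omega
        exact this
    · exact ⟨(h k hk).2.1, (h k hk).2.2.1⟩
  · rintro ⟨h1, h2⟩ i hi
    have hin := Finset.mem_range.1 hi
    refine ⟨?_, (h2 i hi).1, (h2 i hi).2, ?_⟩
    · have e1 : ((-(n : ℤ), (i : ℤ)), hor) ∈ edges sqSteps (square n) := by
        rw [mem_edges]
        simp [sqSteps, mem_square, hor]
        omega
      have e2 : ¬ IsAfter (square n) ((-(n : ℤ), (i : ℤ)), hor) := by
        simp [IsAfter, mem_square, hor, ver]
      rw [h1 _ e1 e2, hI _ e1 e2]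
      trivial
    · have e1 : ((-(i : ℤ), 0), ver) ∈ edges sqSteps (square n) := by
        rw [mem_edges]
        simp [sqSteps, mem_square, ver]
        omega
      have e2 : ¬ IsAfter (square n) ((-(i : ℤ), 0), ver) := by
        simp [IsAfter, mem_square, ver]
      rw [h1 _ e1 e2, hI _ e1 e2]
      trivial

theorem junk_not_mem {n : ℕ} {A : Finset Edge} (hA : A ⊆ edges sqSteps (square n)) :
    ((1, 0), hor) ∉ A := by
  intro h
  have := mem_edges.1 (hA h)
  simp [mem_square, hor] at this

theorem vacuum_sqFront {N n m : ℕ} (hm : m = N + n) {A : Finset Edge}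
    (hA : A ⊆ edges sqSteps (square n)) :
    vacuum m (fun l => decide (sqFront N n 0 n l ∈ A)) = if SqFinalEmpty n A then 1 else 0 := by
  have hj := junk_not_mem hA
  subst hm
  unfold vacuum
  refine if_congr ⟨fun h k hk => ?_, fun h t k hk => ?_⟩ rfl rfl
  · rw [Finset.mem_range] at hk
    have h0 := h 0 (N + k) (by omega)
    have h1 := h 1 k (by omega)
    simp [sqFront, hk, not_le.2 hk] at h0 h1
    refine ⟨h0, ?_⟩
    split_ifs at h1 with hk0
    · subst hk0
      simpa using h1
    · exact h1
  · rw [decide_eq_false_iff_not]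
    fin_cases t
    · by_cases hkN : k < N
      · simpa [sqFront, hkN] using hj
      · have := (h (k - N) (Finset.mem_range.2 (by omega))).1
        rw [Nat.cast_sub (by omega)] at this
        simpa [sqFront, hkN, hk, not_le.2 hk] using this
    · by_cases hkn : n ≤ k
      · simpa [sqFront, hkn] using hj
      · have := (h k (Finset.mem_range.2 (by omega))).2
        by_cases hk0 : k = 0
        · subst hk0
          simpa [sqFront, hkn] using this
        · simpa [sqFront, hkn, hk0] using this
    · simpa [sqFront] using hj

/-- Rows from `N` on and columns before `n` start occupied, all other lines empty. So the lines of
the square carry domain wall data, and the others agree with their parking edge. -/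
theorem initState_eq_sqFront {N n m : ℕ} (hm : m = N + n) (h1 : N ≤ n) (h2 : n ≤ N + 1) :
    initState m = fun l => decide (sqFront N n n n l ∈ sqInitEdges n) := by
  have hj : ((1, 0), hor) ∉ sqInitEdges n := junk_not_mem (Finset.filter_subset _ _)
  subst hm
  funext ⟨t, k⟩
  by_cases hk : k < N + n
  · fin_cases t
    · refine (initState_hL hk).trans ?_
      rw [decide_eq_decide]
      by_cases hkN : k < N
      · simp [sqFront, hkN, hj]
        omega
      · simp [sqFront, hkN, hk, not_le.2 hk, sqInitEdges, mem_edges, IsAfter, mem_square, sqSteps,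
          hor, ver]
        omega
    · refine (initState_vL hk).trans ?_
      rw [decide_eq_decide]
      by_cases hkn : n ≤ k
      · simp [sqFront, hkn, hj]
        omega
      · simp [sqFront, hkn, not_le.1 hkn, sqInitEdges, mem_edges, IsAfter, mem_square, sqSteps, ver]
        omega
    · refine (initState_dL _ k).trans ?_
      simp [sqFront, hj]
  · rw [initState_of_le (not_lt.1 hk)]
    symm
    rw [decide_eq_false_iff_not]
    fin_cases t
    · simp [sqFront, not_lt.1 hk, hj]
    · simp [sqFront, show n ≤ k by omega, hj]
    · simp [sqFront, hj]

theorem squareOp_initState {N n m : ℕ} (hn : 1 ≤ n) (hm : m = N + n) (h1 : N ≤ n) (h2 : n ≤ N + 1)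
    (x : ℂ) :
    squareOp (colParam (rt2 * x)) N n n (vacuum m) (initState m) = Z6V n x := by
  rw [initState_eq_sqFront hm h1 h2, squareOp_apply_eq_sum (colParam (rt2 * x)) N
    (A₀ := sqInitEdges n) (Finset.filter_subset _ _) (fun e he => (Finset.mem_filter.1 he).2) (vacuum m), Z6V_eq_sum hn,
    iceConfigs, Finset.filter_filter, Finset.sum_filter, Finset.sum_filter]
  refine Finset.sum_congr rfl fun A hA => ?_
  rw [vacuum_sqFront hm (Finset.mem_powerset.1 hA)]
  by_cases h1 : ∀ e ∈ edges sqSteps (square n), ¬ IsAfter (square n) e →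
    (e ∈ A ↔ e ∈ sqInitEdges n)
  · rw [if_pos h1]
    by_cases h2 : SqFinalEmpty n A
    · have h3 := boundaryDW_iff.2 ⟨h1, h2⟩
      rw [if_pos h2, mul_one, prod_wt_sqNodes x N hn
        fun k hk => (h2 k (Finset.mem_range.2 hk)).1]
      by_cases h4 : ∀ v ∈ square n, IceAt sqSteps A v
      · rw [if_pos h4, if_pos ⟨h4, h3⟩]
      · rw [if_neg h4, if_neg fun h => h4 h.1]
    · rw [if_neg h2, mul_zero, if_neg fun h => h2 (boundaryDW_iff.1 h.2).2]
  · rw [if_neg h1, if_neg fun h => h1 (boundaryDW_iff.1 h.2).1]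

/-! ### The relation between the two models -/

/-- In each frozen triangle the nonzero exponents are $N,\dots,1$, so the powers of $\sqrt2$
multiply to $2^{N(N+1)/2}=2^N\,2^{N(N-1)/2}$. The last column adds $x^N$. -/
theorem prod_colParam {N n : ℕ} (hn : 1 ≤ n) (h1 : N ≤ n) (h2 : n ≤ N + 1) (x : ℂ) :
    (∏ i ∈ Finset.Ico n (N + n), colParam (rt2 * x) i ^ (N + n - i)) *
      ∏ i ∈ Finset.range n, colParam (rt2 * x) i ^ (N - i) =
      2 ^ (N * (N - 1) / 2) * (2 * x) ^ N := by
  have e1 : ∏ i ∈ Finset.Ico n (N + n), colParam (rt2 * x) i ^ (N + n - i) =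
      ∏ k ∈ Finset.range N, rt2 ^ (N - k) := by
    rw [Finset.prod_Ico_eq_prod_range, Nat.add_sub_cancel]
    refine Finset.prod_congr rfl fun k _ => ?_
    rw [colParam, if_neg (by omega), show N + n - (n + k) = N - k by omega]
  have e2 : ∏ i ∈ Finset.range n, colParam (rt2 * x) i ^ (N - i) =
      x ^ N * ∏ k ∈ Finset.range n, rt2 ^ (N - k) := by
    obtain ⟨r, rfl⟩ : ∃ r, n = r + 1 := ⟨n - 1, by omega⟩
    rw [Finset.prod_range_succ', Finset.prod_range_succ']
    simp only [colParam, Nat.add_eq_zero_iff, one_ne_zero, and_false, if_false, if_true, mul_pow,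
      Nat.sub_zero]
    ring
  have e3 : ∏ k ∈ Finset.range n, rt2 ^ (N - k) = ∏ k ∈ Finset.range N, rt2 ^ (N - k) := by
    -- For $n=N+1$ the extra column has no frozen crossing.
    obtain rfl | rfl : n = N ∨ n = N + 1 := by omega
    · rfl
    · rw [Finset.prod_range_succ, Nat.sub_self, pow_zero, mul_one]
  have e4 : (∏ k ∈ Finset.range N, rt2 ^ (N - k)) * ∏ k ∈ Finset.range N, rt2 ^ (N - k) =
      2 ^ N * 2 ^ (N * (N - 1) / 2) := by
    rw [← Finset.prod_mul_distrib, ← Finset.sum_range_id, ← Finset.sum_range_reflect,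
      ← Finset.prod_pow_eq_pow_sum]
    conv_rhs => rw [← Finset.card_range N, ← Finset.prod_const, Finset.card_range,
      ← Finset.prod_mul_distrib]
    refine Finset.prod_congr rfl fun k hk => ?_
    have := Finset.mem_range.1 hk
    -- $\sqrt2^{\,N-k}\sqrt2^{\,N-k}=2\cdot2^{N-1-k}$; the separate factors $2$ make up $2^N$.
    rw [← mul_pow, rt2_mul_self, ← pow_succ']
    congr 1
    omega
  rw [e1, e2, e3, mul_left_comm, e4, mul_pow]
  ring

theorem Z20V3_of_ne_zero {N n : ℕ} (hn : 1 ≤ n) (h1 : N ≤ n) (h2 : n ≤ N + 1) {x : ℂ}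
    (hx : x ≠ 0) :
    Z20V3 (N + n) (2 * x - 1) = 2 ^ (N * (N - 1) / 2) * (2 * x) ^ N * Z6V n x := by
  have hb : rt2 * x ≠ 0 := mul_ne_zero rt2_ne_zero hx
  have h := Z20V3_eq_colsOp (m := N + n) (by omega) hb
  rw [← mul_assoc, rt2_mul_self] at h
  rw [h, colsOp_vacuum_apply _ (colParam_ne_zero hb) le_rfl (initState_dL _),
    colsOp_zero_apply _ rfl h1 h2 ?_ ?_, squareOp_initState hn rfl h1 h2,
    prod_colParam hn h1 h2]
  · intro j hj
    rw [initState_hL hj, decide_eq_decide]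
    omega
  · intro i hi
    rw [initState_vL hi, decide_eq_decide]
    omega

/-- Both sides are polynomials in $\tau$; the excluded point $\tau=-1$, where $b=0$, is reached by
continuity. -/
theorem Z20V3_eq {N n : ℕ} (hn : 1 ≤ n) (h1 : N ≤ n) (h2 : n ≤ N + 1) (τ : ℂ) :
    Z20V3 (N + n) τ = 2 ^ (N * (N - 1) / 2) * (τ + 1) ^ N * Z6V n ((τ + 1) / 2) := by
  have hd : Dense ({-1}ᶜ : Set ℂ) := dense_compl_singleton (-1)
  refine congrFun (f := Z20V3 (N + n))
    (g := fun t => 2 ^ (N * (N - 1) / 2) * (t + 1) ^ N * Z6V n ((t + 1) / 2))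
    (Continuous.ext_on hd ?_ ?_ ?_) τ
  · unfold Z20V3
    fun_prop
  · unfold Z6V
    fun_prop
  · intro t ht
    have h := Z20V3_of_ne_zero hn h1 h2 (x := (t + 1) / 2) (by
      intro h0
      apply ht
      rw [Set.mem_singleton_iff]
      linear_combination 2 * h0)
    rw [show 2 * ((t + 1) / 2) = t + 1 by ring, add_sub_cancel_right] at h
    exact h


/-! ### Symmetries of the triangle -/

theorem card_filter_powerset_eq {E : Finset Edge} {T : Finset Edge → Finset Edge}
    (hT : ∀ A, T A ⊆ E) (hTT : ∀ A ⊆ E, T (T A) = A) {P Q : Finset Edge → Prop} [DecidablePred P]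
    [DecidablePred Q] (h : ∀ A ⊆ E, P A ↔ Q (T A)) :
    (E.powerset.filter P).card = (E.powerset.filter Q).card := by
  refine Finset.card_nbij' T T ?_ ?_ ?_ ?_
  · intro A hA
    simp only [Finset.coe_filter, Finset.mem_powerset, Set.mem_ofPred_eq] at hA ⊢
    exact ⟨hT A, (h A hA.1).1 hA.2⟩
  · intro A hA
    simp only [Finset.coe_filter, Finset.mem_powerset, Set.mem_ofPred_eq] at hA ⊢
    refine ⟨hT A, (h _ (hT A)).2 ?_⟩
    rw [hTT A hA.1]
    exact hA.2
  · intro A hA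
    simp only [Finset.coe_filter, Finset.mem_powerset, Set.mem_ofPred_eq] at hA
    exact hTT A hA.1
  · intro A hA
    simp only [Finset.coe_filter, Finset.mem_powerset, Set.mem_ofPred_eq] at hA
    exact hTT A hA.1

/-- The edges incident to the triangle of size `m`. -/
abbrev triEdges (m : ℕ) : Finset Edge := edges triSteps (triangle m)

theorem mem_triEdges_cases {m : ℕ} {e : Edge} (h : e ∈ triEdges m) :
    e.2 = hor ∨ e.2 = dia ∨ e.2 = ver := by
  have := (mem_edges.1 h).1
  simpa [triSteps] using this

theorem hor_mem_triEdges {m : ℕ} {x y : ℤ} : ((x, y), hor) ∈ triEdges m ↔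
    (x ≤ 0 ∧ -x ≤ y ∧ y < m) ∨ (x + 1 ≤ 0 ∧ -(x + 1) ≤ y ∧ y < m) := by
  simp [mem_edges, triSteps, mem_triangle, hor]

theorem dia_mem_triEdges {m : ℕ} {x y : ℤ} : ((x, y), dia) ∈ triEdges m ↔
    (x ≤ 0 ∧ -x ≤ y ∧ y < m) ∨ (x + 1 ≤ 0 ∧ -(x + 1) ≤ y - 1 ∧ y - 1 < m) := by
  simp [mem_edges, triSteps, mem_triangle, dia, sub_eq_add_neg]

theorem ver_mem_triEdges {m : ℕ} {x y : ℤ} : ((x, y), ver) ∈ triEdges m ↔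
    (x ≤ 0 ∧ -x ≤ y ∧ y < m) ∨ (x ≤ 0 ∧ -x ≤ y - 1 ∧ y - 1 < m) := by
  simp [mem_edges, triSteps, mem_triangle, ver, sub_eq_add_neg]

theorem hitsLastColumnAt_triangle_iff {m : ℕ} {A : Finset Edge} (hA : A ⊆ triEdges m)
    (hice : ∀ v ∈ triangle m, IceAt triSteps A v)
    (h1 : ∀ i < m, eastHor i ∉ A) (h2 : ∀ i < m, eastDia i ∉ A)
    (h3 : northVer m 0 ∉ A) {k : ℕ} (hk : k ∈ Finset.Icc 1 m) :
    HitsLastColumnAt triSteps m A k ↔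
      ((0, ((k - 1 : ℕ) : ℤ)), ver) ∈ A ∧ ((0, (k : ℤ)), ver) ∉ A := by
  have hv : ∀ j < m, (Visited triSteps A (0, (j : ℤ)) ↔ ((0, (j : ℤ)), ver) ∈ A) ∧
      (((0, (j : ℤ)) - ver, ver) ∈ A → ((0, (j : ℤ)), ver) ∈ A) := by
    intro j hj
    refine iceAt_triSteps_of_empty (hice _ ?_) (h1 j hj) (h2 j hj)
    rw [mem_triangle]
    simp only
    omega
  have hm' : ((0, (m : ℤ)), ver) ∉ A := by simpa [northVer] using h3
  refine hitsLastColumnAt_iff (fun j hj => (hv j hj).1) (fun j h => ?_) hm' hk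
  rcases Nat.lt_or_ge j m with hj | hj
  · refine (hv j hj).2 ?_
    simpa [ver] using h
  · exact absurd h (northVer_not_mem (by omega) hA)

/-! ### The symmetry between 20V₃ and 20V₂. -/

/-- The shear reflection of the triangle, which exchanges horizontal and diagonal edges. -/
def flipEdge (m : ℕ) (e : Edge) : Edge :=
  if e.2 = hor then ((e.1.1, m - 1 - e.1.1 - e.1.2), dia)
  else if e.2 = dia then ((e.1.1, m - 1 - e.1.1 - e.1.2), hor)
  else ((e.1.1, m - e.1.1 - e.1.2), ver)

/-- The shear reflection of a configuration, with the vertical edges flipped. -/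
def flipConfig (m : ℕ) (A : Finset Edge) : Finset Edge :=
  (triEdges m).filter fun e => if e.2 = ver then flipEdge m e ∉ A else flipEdge m e ∈ A

theorem hor_mem_flipConfig {m : ℕ} {A : Finset Edge} {x y : ℤ} (h : ((x, y), hor) ∈ triEdges m) :
    ((x, y), hor) ∈ flipConfig m A ↔ ((x, (m : ℤ) - 1 - x - y), dia) ∈ A := by
  rw [flipConfig, Finset.mem_filter]
  simp [h, flipEdge, hor, ver]

theorem dia_mem_flipConfig {m : ℕ} {A : Finset Edge} {x y : ℤ} (h : ((x, y), dia) ∈ triEdges m) :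
    ((x, y), dia) ∈ flipConfig m A ↔ ((x, (m : ℤ) - 1 - x - y), hor) ∈ A := by
  rw [flipConfig, Finset.mem_filter]
  simp [h, flipEdge, hor, ver, dia]

theorem ver_mem_flipConfig {m : ℕ} {A : Finset Edge} {x y : ℤ} (h : ((x, y), ver) ∈ triEdges m) :
    ((x, y), ver) ∈ flipConfig m A ↔ ((x, (m : ℤ) - x - y), ver) ∉ A := by
  rw [flipConfig, Finset.mem_filter]
  simp [h, flipEdge, hor, ver, dia]

theorem flipConfig_flipConfig {m : ℕ} {A : Finset Edge} (hA : A ⊆ triEdges m) :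
    flipConfig m (flipConfig m A) = A := by
  ext ⟨⟨x, y⟩, s⟩
  by_cases he : ((x, y), s) ∈ triEdges m
  · rcases mem_triEdges_cases he with rfl | rfl | rfl
    · have : ((x, (m : ℤ) - 1 - x - y), dia) ∈ triEdges m := by
        rw [hor_mem_triEdges] at he
        rw [dia_mem_triEdges]
        omega
      rw [hor_mem_flipConfig he, dia_mem_flipConfig this]
      ring_nf
    · have : ((x, (m : ℤ) - 1 - x - y), hor) ∈ triEdges m := by
        rw [dia_mem_triEdges] at he
        rw [hor_mem_triEdges]
        omega
      rw [dia_mem_flipConfig he, hor_mem_flipConfig this]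
      ring_nf
    · have : ((x, (m : ℤ) - x - y), ver) ∈ triEdges m := by
        rw [ver_mem_triEdges] at he ⊢
        omega
      rw [ver_mem_flipConfig he, ver_mem_flipConfig this, not_not]
      ring_nf
  · exact ⟨fun h => absurd (Finset.filter_subset _ _ h) he, fun h => absurd (hA h) he⟩

/-- The involution $(x,y)\mapsto(x,m-1-x-y)$ swaps the steps `hor` and `dia` and reverses `ver`.
Complementing the vertical edges is therefore just transporting the arrows, which respects the ice
rule. -/
theorem iceAt_flipConfig {m : ℕ} {A : Finset Edge} {x y : ℤ} (hv : (x, y) ∈ triangle m) :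
    IceAt triSteps (flipConfig m A) (x, y) ↔ IceAt triSteps A (x, m - 1 - x - y) := by
  rw [mem_triangle] at hv
  simp only at hv
  have h1 : ((x, y) - hor, hor) ∈ flipConfig m A ↔ ((x, (m : ℤ) - 1 - x - y) - dia, dia) ∈ A := by
    simp only [hor, dia, Prod.mk_sub_mk]
    rw [hor_mem_flipConfig (by rw [hor_mem_triEdges]; omega)]
    ring_nf
  have h2 : ((x, y) - dia, dia) ∈ flipConfig m A ↔ ((x, (m : ℤ) - 1 - x - y) - hor, hor) ∈ A := by
    simp only [hor, dia, Prod.mk_sub_mk]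
    rw [dia_mem_flipConfig (by rw [dia_mem_triEdges]; omega)]
    ring_nf
  have h3 : ((x, y) - ver, ver) ∈ flipConfig m A ↔ ((x, (m : ℤ) - 1 - x - y), ver) ∉ A := by
    simp only [ver, Prod.mk_sub_mk]
    rw [ver_mem_flipConfig (by rw [ver_mem_triEdges]; omega)]
    ring_nf
  have h4 : ((x, y), ver) ∈ flipConfig m A ↔ ((x, (m : ℤ) - 1 - x - y) - ver, ver) ∉ A := by
    simp only [ver, Prod.mk_sub_mk]
    rw [ver_mem_flipConfig (by rw [ver_mem_triEdges]; omega)]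
    ring_nf
  have h5 := hor_mem_flipConfig (A := A) (m := m) (x := x) (y := y)
    (by rw [hor_mem_triEdges]; omega)
  have h6 := dia_mem_flipConfig (A := A) (m := m) (x := x) (y := y)
    (by rw [dia_mem_triEdges]; omega)
  rw [iceAt_triSteps, iceAt_triSteps]
  simp only [h1, h2, h3, h4, h5, h6, triIce]
  generalize ((x, (m : ℤ) - 1 - x - y) : ℤ × ℤ) = w
  by_cases p3 : (w - ver, ver) ∈ A <;> by_cases p6 : (w, ver) ∈ A <;> simp [p3, p6] <;> omega

/-- The North and diagonal boundaries are exchanged, and the East boundary is turned upside down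
with its two kinds of edges swapped. -/
theorem boundary2_flipConfig {m : ℕ} {A : Finset Edge} :
    Boundary2 m (flipConfig m A) ↔ Boundary3 m A := by
  have h1 : ∀ i < m, (northVer m i ∈ flipConfig m A ↔ diagVer i ∉ A) := by
    intro i hi
    rw [northVer, ver_mem_flipConfig (by rw [ver_mem_triEdges]; omega), diagVer]
    ring_nf
  have h2 : ∀ i < m, (northDia m i ∈ flipConfig m A ↔ diagHor i ∈ A) := by
    intro i hi
    rw [northDia, dia_mem_flipConfig (by rw [dia_mem_triEdges]; omega), diagHor]
    ring_nf
  have h3 : ∀ i < m, (eastHor i ∈ flipConfig m A ↔ eastDia (m - 1 - i) ∈ A) := by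
    intro i hi
    rw [eastHor, hor_mem_flipConfig (by rw [hor_mem_triEdges]; omega), eastDia,
      show ((m - 1 - i : ℕ) : ℤ) = (m : ℤ) - 1 - 0 - i by omega]
  have h4 : ∀ i < m, (eastDia i ∈ flipConfig m A ↔ eastHor (m - 1 - i) ∈ A) := by
    intro i hi
    rw [eastDia, dia_mem_flipConfig (by rw [dia_mem_triEdges]; omega), eastHor,
      show ((m - 1 - i : ℕ) : ℤ) = (m : ℤ) - 1 - 0 - i by omega]
  have h5 : ∀ i < m, (diagHor i ∈ flipConfig m A ↔ northDia m i ∈ A) := by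
    intro i hi
    rw [diagHor, hor_mem_flipConfig (by rw [hor_mem_triEdges]; omega), northDia]
    ring_nf
  have h6 : ∀ i < m, (diagVer i ∈ flipConfig m A ↔ northVer m i ∉ A) := by
    intro i hi
    rw [diagVer, ver_mem_flipConfig (by rw [ver_mem_triEdges]; omega), northVer]
    ring_nf
  constructor
  · intro h i hi
    have him := Finset.mem_range.1 hi
    have g := h i hi
    have g' := h (m - 1 - i) (Finset.mem_range.2 (by omega))
    rw [h1 i him, h2 i him, h5 i him, h6 i him] at g
    rw [h3 _ (by omega), h4 _ (by omega), show m - 1 - (m - 1 - i) = i by omega] at g'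
    refine ⟨g.2.2.2.2.2, g.2.2.2.2.1, g'.2.2.2.1, g'.2.2.1, g.2.1, ?_⟩
    have := g.1
    -- The vertical edges are complemented, and $2i+1\le m$ is the negation of $m\le2i$.
    constructor
    · intro h
      by_contra hc
      exact this.2 (by omega) h
    · intro h
      by_contra hc
      have := this.1 hc
      omega
  · intro h i hi
    have him := Finset.mem_range.1 hi
    have g := h i hi
    have g' := h (m - 1 - i) (Finset.mem_range.2 (by omega))
    rw [h1 i him, h2 i him, h5 i him, h6 i him, h3 i him, h4 i him]
    refine ⟨?_, g.2.2.2.2.1, g'.2.2.2.1, g'.2.2.1, g.2.1, g.1⟩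
    rw [g.2.2.2.2.2]
    omega

/-- On the vertical edges $0,\dots,m$ of the last column the map is reversal $j\mapsto m-j$ followed
by complementation. An occupied segment $0,\dots,k-1$ becomes $0,\dots,m-k$. -/
theorem count2_eq_count3 {m k : ℕ} (hk : k ∈ Finset.Icc 1 m) :
    count2 m k = count3 m (m + 1 - k) := by
  obtain ⟨hk1, hk2⟩ := Finset.mem_Icc.1 hk
  symm
  rw [count2, count3, iceConfigs, Finset.filter_filter, Finset.filter_filter]
  refine card_filter_powerset_eq (T := flipConfig m) (fun A => Finset.filter_subset _ _)
    (fun A hA => flipConfig_flipConfig hA) fun A hA => ?_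
  have e1 : (∀ v ∈ triangle m, IceAt triSteps A v) ↔
      ∀ v ∈ triangle m, IceAt triSteps (flipConfig m A) v := by
    constructor
    · rintro h ⟨x, y⟩ hv
      rw [iceAt_flipConfig hv]
      refine h _ ?_
      rw [mem_triangle] at hv ⊢
      simp only at hv ⊢
      omega
    · rintro h ⟨x, y⟩ hv
      have hv' : (x, (m : ℤ) - 1 - x - y) ∈ triangle m := by
        rw [mem_triangle] at hv ⊢
        simp only at hv ⊢
        omega
      have := h _ hv'
      rwa [iceAt_flipConfig hv', show (m : ℤ) - 1 - x - (m - 1 - x - y) = y by ring] at this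
  refine (and_congr_right ?_).trans (and_congr_left' e1)
  intro hice
  rw [boundary2_flipConfig]
  refine and_congr_right fun hB => ?_
  have hice' := e1.1 hice
  have hB' := boundary2_flipConfig.2 hB
  rw [hitsLastColumnAt_triangle_iff hA hice (fun i hi => (hB i (Finset.mem_range.2 hi)).2.2.1)
      (fun i hi => (hB i (Finset.mem_range.2 hi)).2.2.2.1)
      (hB 0 (Finset.mem_range.2 (by omega))).1 (Finset.mem_Icc.2 ⟨by omega, by omega⟩),
    hitsLastColumnAt_triangle_iff (A := flipConfig m A) (Finset.filter_subset _ _) hice'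
      (fun i hi => (hB' i (Finset.mem_range.2 hi)).2.2.1)
      (fun i hi => (hB' i (Finset.mem_range.2 hi)).2.2.2.1)
      (fun h => by
        have := (hB' 0 (Finset.mem_range.2 (by omega))).1.1 h
        omega) hk,
    ver_mem_flipConfig (by rw [ver_mem_triEdges]; omega),
    ver_mem_flipConfig (by rw [ver_mem_triEdges]; omega), not_not, and_comm,
    show ((m + 1 - k : ℕ) : ℤ) = (m : ℤ) - 0 - ((k - 1 : ℕ) : ℤ) by omega,
    show ((m + 1 - k - 1 : ℕ) : ℤ) = (m : ℤ) - 0 - k by omega]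

/-! ### The symmetry between 20V₂ and 20V₁. -/

/-- The reflection of the triangle, which exchanges horizontal and vertical edges. -/
def reflEdge (m : ℕ) (e : Edge) : Edge :=
  if e.2 = hor then ((e.1.2 - m + 1, e.1.1 + m), ver)
  else if e.2 = dia then ((e.1.2 - m, e.1.1 + m), dia)
  else ((e.1.2 - m, e.1.1 + m - 1), hor)

/-- The reflection of a configuration. -/
def reflConfig (m : ℕ) (A : Finset Edge) : Finset Edge :=
  (triEdges m).filter fun e => reflEdge m e ∈ A

theorem hor_mem_reflConfig {m : ℕ} {A : Finset Edge} {x y : ℤ} (h : ((x, y), hor) ∈ triEdges m) :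
    ((x, y), hor) ∈ reflConfig m A ↔ ((y - m + 1, x + (m : ℤ)), ver) ∈ A := by
  rw [reflConfig, Finset.mem_filter]
  simp [h, reflEdge]

theorem dia_mem_reflConfig {m : ℕ} {A : Finset Edge} {x y : ℤ} (h : ((x, y), dia) ∈ triEdges m) :
    ((x, y), dia) ∈ reflConfig m A ↔ ((y - m, x + (m : ℤ)), dia) ∈ A := by
  rw [reflConfig, Finset.mem_filter]
  simp [h, reflEdge, hor, dia]

theorem ver_mem_reflConfig {m : ℕ} {A : Finset Edge} {x y : ℤ} (h : ((x, y), ver) ∈ triEdges m) :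
    ((x, y), ver) ∈ reflConfig m A ↔ ((y - m, x + (m : ℤ) - 1), hor) ∈ A := by
  rw [reflConfig, Finset.mem_filter]
  simp [h, reflEdge, hor, ver, dia]

theorem reflConfig_reflConfig {m : ℕ} {A : Finset Edge} (hA : A ⊆ triEdges m) :
    reflConfig m (reflConfig m A) = A := by
  ext ⟨⟨x, y⟩, s⟩
  by_cases he : ((x, y), s) ∈ triEdges m
  · rcases mem_triEdges_cases he with rfl | rfl | rfl
    · have : ((y - m + 1, x + (m : ℤ)), ver) ∈ triEdges m := by
        rw [hor_mem_triEdges] at he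
        rw [ver_mem_triEdges]
        omega
      rw [hor_mem_reflConfig he, ver_mem_reflConfig this]
      ring_nf
    · have : ((y - m, x + (m : ℤ)), dia) ∈ triEdges m := by
        rw [dia_mem_triEdges] at he ⊢
        omega
      rw [dia_mem_reflConfig he, dia_mem_reflConfig this]
      ring_nf
    · have : ((y - m, x + (m : ℤ) - 1), hor) ∈ triEdges m := by
        rw [ver_mem_triEdges] at he
        rw [hor_mem_triEdges]
        omega
      rw [ver_mem_reflConfig he, hor_mem_reflConfig this]
      ring_nf
  · exact ⟨fun h => absurd (Finset.filter_subset _ _ h) he, fun h => absurd (hA h) he⟩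

/-- The reflection sends every step to the negative of a step. Keeping occupation numbers thus
reverses all transported arrows, and the ice rule is invariant under this reversal. -/
theorem iceAt_reflConfig {m : ℕ} {A : Finset Edge} {x y : ℤ} (hv : (x, y) ∈ triangle m) :
    IceAt triSteps (reflConfig m A) (x, y) ↔ IceAt triSteps A (y - m + 1, x + m - 1) := by
  rw [mem_triangle] at hv
  simp only at hv
  have h1 : ((x, y) - hor, hor) ∈ reflConfig m A ↔ ((y - m + 1, x + (m : ℤ) - 1), ver) ∈ A := by
    simp only [hor, Prod.mk_sub_mk]
    rw [hor_mem_reflConfig (by rw [hor_mem_triEdges]; omega)]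
    ring_nf
  have h2 : ((x, y) - dia, dia) ∈ reflConfig m A ↔ ((y - m + 1, x + (m : ℤ) - 1), dia) ∈ A := by
    simp only [dia, Prod.mk_sub_mk]
    rw [dia_mem_reflConfig (by rw [dia_mem_triEdges]; omega)]
    ring_nf
  have h3 : ((x, y) - ver, ver) ∈ reflConfig m A ↔ ((y - m + 1, x + (m : ℤ) - 1), hor) ∈ A := by
    simp only [ver, Prod.mk_sub_mk]
    rw [ver_mem_reflConfig (by rw [ver_mem_triEdges]; omega)]
    ring_nf
  have h4 : ((x, y), ver) ∈ reflConfig m A ↔ ((y - m + 1, x + (m : ℤ) - 1) - hor, hor) ∈ A := by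
    simp only [hor, Prod.mk_sub_mk]
    rw [ver_mem_reflConfig (by rw [ver_mem_triEdges]; omega)]
    ring_nf
  have h5 : ((x, y), hor) ∈ reflConfig m A ↔ ((y - m + 1, x + (m : ℤ) - 1) - ver, ver) ∈ A := by
    simp only [ver, Prod.mk_sub_mk]
    rw [hor_mem_reflConfig (by rw [hor_mem_triEdges]; omega)]
    ring_nf
  have h6 : ((x, y), dia) ∈ reflConfig m A ↔ ((y - m + 1, x + (m : ℤ) - 1) - dia, dia) ∈ A := by
    simp only [dia, Prod.mk_sub_mk]
    rw [dia_mem_reflConfig (by rw [dia_mem_triEdges]; omega)]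
    ring_nf
  rw [iceAt_triSteps, iceAt_triSteps]
  simp only [h1, h2, h3, h4, h5, h6, triIce]
  omega

theorem boundary1_reflConfig {m : ℕ} {A : Finset Edge} :
    Boundary1 m (reflConfig m A) ↔ Boundary2 m A := by
  have e : ∀ i < m, ((m - 1 - i : ℕ) : ℤ) = (m : ℤ) - 1 - i := by
    intro i hi
    omega
  have h1 : ∀ i < m, (northVer m i ∈ reflConfig m A ↔ eastHor (m - 1 - i) ∈ A) := by
    intro i hi
    rw [northVer, ver_mem_reflConfig (by rw [ver_mem_triEdges]; omega), eastHor, e i hi]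
    ring_nf
  have h2 : ∀ i < m, (northDia m i ∈ reflConfig m A ↔ eastDia (m - 1 - i) ∈ A) := by
    intro i hi
    rw [northDia, dia_mem_reflConfig (by rw [dia_mem_triEdges]; omega), eastDia, e i hi]
    ring_nf
  have h3 : ∀ i < m, (eastHor i ∈ reflConfig m A ↔ northVer m (m - 1 - i) ∈ A) := by
    intro i hi
    rw [eastHor, hor_mem_reflConfig (by rw [hor_mem_triEdges]; omega), northVer, e i hi]
    ring_nf
  have h4 : ∀ i < m, (eastDia i ∈ reflConfig m A ↔ northDia m (m - 1 - i) ∈ A) := by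
    intro i hi
    rw [eastDia, dia_mem_reflConfig (by rw [dia_mem_triEdges]; omega), northDia, e i hi]
    ring_nf
  have h5 : ∀ i < m, (diagHor i ∈ reflConfig m A ↔ diagVer (m - 1 - i) ∈ A) := by
    intro i hi
    rw [diagHor, hor_mem_reflConfig (by rw [hor_mem_triEdges]; omega), diagVer, e i hi]
    ring_nf
  have h6 : ∀ i < m, (diagVer i ∈ reflConfig m A ↔ diagHor (m - 1 - i) ∈ A) := by
    intro i hi
    rw [diagVer, ver_mem_reflConfig (by rw [ver_mem_triEdges]; omega), diagHor, e i hi]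
    ring_nf
  constructor
  · intro h i hi
    have him := Finset.mem_range.1 hi
    have g := h (m - 1 - i) (Finset.mem_range.2 (by omega))
    rw [h1 _ (by omega), h2 _ (by omega), h3 _ (by omega), h4 _ (by omega), h5 _ (by omega),
      h6 _ (by omega), show m - 1 - (m - 1 - i) = i by omega] at g
    refine ⟨?_, ?_, g.1, g.2.1, g.2.2.2.2.2, g.2.2.2.2.1⟩
    · rw [g.2.2.1]
      omega
    · rw [g.2.2.2.1]
      omega
  · intro h i hi
    have him := Finset.mem_range.1 hi
    have g := h (m - 1 - i) (Finset.mem_range.2 (by omega))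
    rw [h1 i him, h2 i him, h3 i him, h4 i him, h5 i him, h6 i him]
    refine ⟨g.2.2.1, g.2.2.2.1, ?_, ?_, g.2.2.2.2.2, g.2.2.2.2.1⟩
    · rw [g.1]
      omega
    · rw [g.2.1]
      omega

/-- Leaving the top line at position $k$ reflects to a horizontal or diagonal path entering the last
column at position $k$. The ice rule there makes this equivalent to the edge below being occupied
and the edge above empty, that is, to position $k$ being the topmost visited one. -/
theorem count1_eq_count2 {m k : ℕ} (hk : k ∈ Finset.Icc 1 m) : count1 m k = count2 m k := by
  obtain ⟨hk1, hk2⟩ := Finset.mem_Icc.1 hk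
  symm
  rw [count1, count2, iceConfigs, Finset.filter_filter, Finset.filter_filter]
  refine card_filter_powerset_eq (T := reflConfig m) (fun A => Finset.filter_subset _ _)
    (fun A hA => reflConfig_reflConfig hA) fun A hA => ?_
  have e1 : (∀ v ∈ triangle m, IceAt triSteps A v) ↔
      ∀ v ∈ triangle m, IceAt triSteps (reflConfig m A) v := by
    constructor
    · rintro h ⟨x, y⟩ hv
      rw [iceAt_reflConfig hv]
      refine h _ ?_
      rw [mem_triangle] at hv ⊢
      simp only at hv ⊢
      omega
    · rintro h ⟨x, y⟩ hv
      have hv' : (y - m + 1, x + (m : ℤ) - 1) ∈ triangle m := by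
        rw [mem_triangle] at hv ⊢
        simp only at hv ⊢
        omega
      have := h _ hv'
      rwa [iceAt_reflConfig hv', show x + (m : ℤ) - 1 - m + 1 = x by ring,
        show y - (m : ℤ) + 1 + m - 1 = y by ring] at this
  refine (and_congr_right ?_).trans (and_congr_left' e1)
  intro hice
  rw [boundary1_reflConfig]
  refine and_congr_right fun hB => ?_
  rw [hitsLastColumnAt_triangle_iff hA hice (fun i hi => (hB i (Finset.mem_range.2 hi)).2.2.1)
      (fun i hi => (hB i (Finset.mem_range.2 hi)).2.2.2.1)
      (fun h => by
        have := (hB 0 (Finset.mem_range.2 (by omega))).1.1 h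
        omega) hk, LeavesTopLineAt,
    dia_mem_reflConfig (by rw [dia_mem_triEdges]; omega),
    ver_mem_reflConfig (by rw [ver_mem_triEdges]; omega)]
  have hw : IceAt triSteps A (0, ((k - 1 : ℕ) : ℤ)) := hice _ (by
    rw [mem_triangle]
    simp only
    omega)
  have hB' := hB (k - 1) (Finset.mem_range.2 (by omega))
  have hE : ((0, ((k - 1 : ℕ) : ℤ)), hor) ∉ A := hB'.2.2.1
  have hE' : ((0, ((k - 1 : ℕ) : ℤ)), dia) ∉ A := hB'.2.2.2.1
  rw [iceAt_triSteps, triIce, decide_eq_false hE, decide_eq_false hE',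
    show (0, ((k - 1 : ℕ) : ℤ)) - hor = ((m : ℤ) - 1 - m, (k : ℤ) - m + m - 1) by
      simp [hor, Prod.ext_iff]; omega,
    show (0, ((k - 1 : ℕ) : ℤ)) - dia = ((m : ℤ) - 1 - m, (k : ℤ) - m + m) by
      simp [dia, Prod.ext_iff]; omega,
    show (0, ((k - 1 : ℕ) : ℤ)) - ver = (0, (k : ℤ)) by
      simp [ver, Prod.ext_iff]; omega] at hw
  by_cases p1 : (((m : ℤ) - 1 - m, (k : ℤ) - m + m - 1), hor) ∈ A <;>
    by_cases p2 : (((m : ℤ) - 1 - m, (k : ℤ) - m + m), dia) ∈ A <;>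
    by_cases p3 : ((0, (k : ℤ)), ver) ∈ A <;>
    by_cases p4 : ((0, ((k - 1 : ℕ) : ℤ)), ver) ∈ A <;>
    simp only [p1, p2, p3, p4, decide_true, decide_false] at hw ⊢ <;> revert hw <;> decide

theorem Z20V1_eq_Z20V2 (m : ℕ) (τ : ℂ) : Z20V1 m τ = Z20V2 m τ :=
  Finset.sum_congr rfl fun k hk => by rw [count1_eq_count2 hk]

theorem Z20V2_eq_Z20V3 (m : ℕ) {τ : ℂ} (hτ : τ ≠ 0) :
    Z20V2 m τ = τ ^ (m - 1) * Z20V3 m τ⁻¹ := by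
  rw [Z20V2, Z20V3, Finset.mul_sum]
  refine Finset.sum_nbij' (fun k => m + 1 - k) (fun k => m + 1 - k) ?_ ?_ ?_ ?_ ?_
  · intro k hk
    rw [Finset.mem_Icc] at hk ⊢
    omega
  · intro k hk
    rw [Finset.mem_Icc] at hk ⊢
    omega
  · intro k hk
    rw [Finset.mem_Icc] at hk
    omega
  · intro k hk
    rw [Finset.mem_Icc] at hk
    omega
  · intro k hk
    rw [count2_eq_count3 hk, mul_left_comm]
    rw [Finset.mem_Icc] at hk
    congr 1
    rw [show m - 1 = (k - 1) + (m + 1 - k - 1) by omega, pow_add, mul_assoc, ← mul_pow,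
      mul_inv_cancel₀ hτ, one_pow, mul_one]

end VertexModel

theorem mainTheorem3 :
    (∀ n : ℕ, 1 ≤ n → ∀ τ : ℂ,
      VertexModel.Z20V3 (2 * n) τ =
          2 ^ (n * (n - 1) / 2) * (τ + 1) ^ n * VertexModel.Z6V n ((τ + 1) / 2) ∧
      VertexModel.Z20V3 (2 * n - 1) τ =
          2 ^ ((n - 1) * (n - 2) / 2) * (τ + 1) ^ (n - 1) *
            VertexModel.Z6V n ((τ + 1) / 2)) ∧
    (∀ m : ℕ, 1 ≤ m →
      (∀ τ : ℂ, VertexModel.Z20V1 m τ = VertexModel.Z20V2 m τ) ∧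
      (∀ τ : ℂ, τ ≠ 0 →
        VertexModel.Z20V2 m τ = τ ^ (m - 1) * VertexModel.Z20V3 m τ⁻¹)) := by
  refine ⟨fun n hn τ => ⟨?_, ?_⟩, fun m _ => ⟨VertexModel.Z20V1_eq_Z20V2 m,
    fun τ hτ => VertexModel.Z20V2_eq_Z20V3 m hτ⟩⟩
  · rw [two_mul]
    exact VertexModel.Z20V3_eq hn le_rfl (by omega) τ
  · have h := VertexModel.Z20V3_eq (N := n - 1) hn (by omega) (by omega) τ
    rw [show n - 1 + n = 2 * n - 1 by omega, show n - 1 - 1 = n - 2 by omega] at h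
    exact h
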